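/- **Setting.** There are $N$ players and $K\ge N$ arms. Player $p_i$ has distinct mean rewards $\mu^{(i)}_a$ for the arms $a$, unknown to it. Each arm $a$ has a strict preference order $\succ_a$ over the players, known to the arm but not to the players. Every agent prefers being matched to being unmatched. In each round $t=1,2,\dots$ every player requests one arm, every requested arm accepts the requesting player it prefers most, and the resulting matching (but not the arms' preferences) is observed by everybody. A player that pulls arm $a$ successfully receives an independent $\mathcal N(\mu^{(i)}_a,1)$ reward. A matching is stable if there is no player–arm pair $(p_i,a)$ such that $p_i$ prefers $a$ to its current match and $a$ prefers $p_i$ to its current match. **OCA-UCB** with delay parameter $\lambda\in(0,1)$. For each arm $a$, player $p_i$ keeps the sets $O^{(i)}_{a,h}$ and $O^{(i)}_{a,l}$ of the players it believes to be ranked by $a$ above and below itself; initially $O^{(i)}_{a,h}=\emptyset$ and $O^{(i)}_{a,l}=P\setminus\{p_i\}$, where $P$ is the set of players. Whenever $p_i$ requests $a$ and loses it to $p_j$, $p_j$ is moved from $O^{(i)}_{a,l}$ to $O^{(i)}_{a,h}$. In round $1$ each player requests a uniformly random arm. In each round $t\ge2$ every player, independently, with probability $\lambda$ repeats its request of round $t-1$;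 otherwise it requests an arm with the largest upper confidence bound in its plausible set. This set consists of the arms that in round $t-1$ were unmatched, were held by $p_i$, or were held by a player in $O^{(i)}_{a,l}$. The upper confidence bound of $a$ is $\infty$ if $p_i$ has never pulled $a$ successfully, and otherwise $\hat\mu+\sqrt{3\log t/(2n)}$, where $n$ is the number of successful pulls of $a$ by $p_i$ before round $t$ and $\hat\mu$ is the mean of the rewards they gave. Ties are broken by an arbitrary fixed rule, which may depend on the round and on the player. CA-UCB is the same algorithm with the plausible set formed from the arms' true preferences ($a$ is plausible for $p_i$ if in round $t-1$ it was unmatched, held by $p_i$, or held by some $p_k$ with $p_i\succ_a p_k$). **Theorem 1.** OCA-UCB converges to stability: 1. almost surely, from some round on, the arm that OCA-UCB selects for each player (when the player is not delayed) has the largest upper confidence bound in the plausible set that CA-UCB would form from the same history; 2. there is a constant $C$ (depending only on the market, $\lambda$ and the tie-breaking rule) such that almost surely, for all sufficiently large $T$, at most $C\log^2T$ of the matchings formed in rounds $1,\dots,T$ are not stable; 3. $\displaystyle\frac1T\sum_{t=1}^{T}\Pr[\text{the matching of round } t \text{ is not stable}]\to0$ as $T\to\infty$. -/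

import Mathlib

open MeasureTheory ProbabilityTheory Filter Topology

noncomputable section

namespace MatchingBandit

open scoped Classical

/-- A (partial) assignment of arms to players; `none` means unmatched. -/
abbrev Matching (N K : ℕ) := Fin N → Option (Fin K)

/-- `η a i` is the mean reward of arm `a` from player `i`: arm `a` prefers `i` to `k` iff
`η a k < η a i`.  If the players request the arms `A`, every requested arm accepts the requesting
player that it prefers most; all other players stay unmatched. -/
def resolve {N K : ℕ} (η : Fin K → Fin N → ℝ) (A : Fin N → Fin K) : Matching N K := fun i =>
  if ∀ k, k ≠ i → A k = A i → η (A i) k < η (A i) i then some (A i) else none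

/-- Player `i` would rather have arm `a` than its partner in `m` (if any). -/
def PlayerWants {N K : ℕ} (μ : Fin N → Fin K → ℝ) (m : Matching N K) (i : Fin N) (a : Fin K) :
    Prop := ∀ b, m i = some b → μ i b < μ i a

/-- Arm `a` would rather have player `i` than its partner in `m` (if any). -/
def ArmWants {N K : ℕ} (η : Fin K → Fin N → ℝ) (m : Matching N K) (i : Fin N) (a : Fin K) :
    Prop := ∀ k, m k = some a → η a k < η a i

/-- `m` is a matching (no arm is shared) and it has no blocking pair.
Being unmatched is the worst outcome for players and for arms. -/
def IsStable {N K : ℕ} (μ : Fin N → Fin K → ℝ) (η : Fin K → Fin N → ℝ) (m : Matching N K) :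
    Prop :=
  (∀ i k a, m i = some a → m k = some a → i = k) ∧
    ¬ ∃ i a, PlayerWants μ m i a ∧ ArmWants η m i a

/-- All the randomness of a run: the arms requested in round `1`; the delay variables
(`(t, i) ↦ D_i(t)`); and the rewards, where the value at `(i, a, n)` is the reward that player `i`
receives at its `n`-th successful pull (counted from `0`) of arm `a`. -/
abbrev Sample (N K : ℕ) :=
  (Fin N → Fin K) × (ℕ × Fin N → Bool) × (Fin N × Fin K × ℕ → ℝ)

/-- The law of the randomness.  All coordinates are independent; first requests are uniform,
delays are Bernoulli with `P (D = true) = lam`, rewards are Gaussian with mean `μ i a`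
and variance `1`. -/
def law {N K : ℕ} (lam : unitInterval) (μ : Fin N → Fin K → ℝ) : Measure (Sample N K) :=
  (Measure.pi fun _ : Fin N => uniformOn (Set.univ : Set (Fin K))).prod
    ((Measure.infinitePi fun _ : ℕ × Fin N => bernoulliMeasure true false lam).prod
      (Measure.infinitePi fun x : Fin N × Fin K × ℕ => gaussianReal (μ x.1 x.2.1) 1))

/-- The state of the market at the end of a round. -/
structure State (N K : ℕ) where
  /-- the arm requested by each player in the round -/
  attempt : Fin N → Fin K
  /-- `higher i a`: the players that `i` believes to be ranked above itself by arm `a` -/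
  higher : Fin N → Fin K → Finset (Fin N)
  /-- `lower i a`: the players that `i` believes to be ranked below itself by arm `a` -/
  lower : Fin N → Fin K → Finset (Fin N)
  /-- the number of successful pulls of arm `a` by player `i` so far -/
  pulls : Fin N → Fin K → ℕ

/-- The upper confidence bound of player `i` for arm `a` used in round `t`; `n` is the number
of successful pulls of `a` by `i` in the rounds before `t`. -/
def ucb {N K : ℕ} (ω : Sample N K) (t : ℕ) (i : Fin N) (a : Fin K) (n : ℕ) : EReal :=
  if n = 0 then ⊤
  else (((∑ j ∈ Finset.range n, ω.2.2 (i, a, j)) / n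
    + Real.sqrt (3 * Real.log t / (2 * n)) : ℝ) : EReal)

/-- The arms of `S` with the largest upper confidence bound for player `i` in round `t`,
when `s` is the state at the end of round `t - 1`. -/
def ucbArgmax {N K : ℕ} (ω : Sample N K) (t : ℕ) (s : State N K) (i : Fin N)
    (S : Finset (Fin K)) : Finset (Fin K) :=
  S.filter fun a => ∀ b ∈ S, ucb ω t i b (s.pulls i b) ≤ ucb ω t i a (s.pulls i a)

/-- CA-UCB's plausible set, formed with the true preferences of the arms: the arms that were
unmatched, held by `i`, or held by a player to whom the arm prefers `i`. -/
def caPlausible {N K : ℕ} (η : Fin K → Fin N → ℝ) (s : State N K) (i : Fin N) :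
    Finset (Fin K) :=
  Finset.univ.filter fun a => ∀ k, resolve η s.attempt k = some a → k ≠ i → η a k < η a i

/-- OCA-UCB's plausible set: the same, with the beliefs of `i` in place of the true preferences. -/
def ocaPlausible {N K : ℕ} (η : Fin K → Fin N → ℝ) (s : State N K) (i : Fin N) :
    Finset (Fin K) :=
  Finset.univ.filter fun a => ∀ k, resolve η s.attempt k = some a → k ≠ i → k ∈ s.lower i a

/-- A tie-breaking rule: in round `t`, player `i` selects `τ t i S` among the arms `S`. -/
abbrev TieBreak (N K : ℕ) := ℕ → Fin N → Finset (Fin K) → Fin K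

/-- The arm that OCA-UCB selects for player `i` in round `t` if the player is not delayed,
when `s` is the state at the end of round `t - 1`. -/
def ocaChoice {N K : ℕ} (η : Fin K → Fin N → ℝ) (τ : TieBreak N K) (ω : Sample N K) (t : ℕ)
    (s : State N K) (i : Fin N) : Fin K :=
  τ t i (ucbArgmax ω t s i (ocaPlausible η s i))

/-- The players to whom `i` lost a conflict over arm `a` (at most one player, the winner), when
the requests are `A`. -/
def lostTo {N K : ℕ} (η : Fin K → Fin N → ℝ) (A : Fin N → Fin K) (i : Fin N) (a : Fin K) :
    Finset (Fin N) :=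
  Finset.univ.filter fun k => A i = a ∧ k ≠ i ∧ resolve η A k = some a

/-- The state after a further round, with requests `A`. -/
def State.next {N K : ℕ} (η : Fin K → Fin N → ℝ) (s : State N K) (A : Fin N → Fin K) :
    State N K where
  attempt := A
  higher i a := s.higher i a ∪ lostTo η A i a
  lower i a := s.lower i a \ lostTo η A i a
  pulls i a := s.pulls i a + if resolve η A i = some a then 1 else 0

/-- OCA-UCB: `run η τ ω t` is the state at the end of round `t`.  The value at `0` is the initial
state: optimistic beliefs, no pulls (its field `attempt` is a placeholder that is never used
as a request of an earlier round). -/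
def run {N K : ℕ} (η : Fin K → Fin N → ℝ) (τ : TieBreak N K) (ω : Sample N K) : ℕ → State N K
  | 0 =>
    { attempt := ω.1
      higher := fun _ _ => ∅
      lower := fun i _ => Finset.univ \ {i}
      pulls := fun _ _ => 0 }
  | t + 1 =>
    (run η τ ω t).next η fun i =>
      if t = 0 then ω.1 i
      else if ω.2.1 (t + 1, i) = true then (run η τ ω t).attempt i
      else ocaChoice η τ ω (t + 1) (run η τ ω t) i

/-- The matching `i ↦ Ā_i(t)` formed in round `t ≥ 1`. -/
def matchingAt {N K : ℕ} (η : Fin K → Fin N → ℝ) (τ : TieBreak N K) (ω : Sample N K) (t : ℕ) :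
    Matching N K :=
  resolve η (run η τ ω t).attempt

/-- The number of rounds among `1, …, T` in which the matching is not stable. -/
def unstableRounds {N K : ℕ} (μ : Fin N → Fin K → ℝ) (η : Fin K → Fin N → ℝ) (τ : TieBreak N K)
    (ω : Sample N K) (T : ℕ) : ℕ :=
  ((Finset.Icc 1 T).filter fun t => ¬ IsStable μ η (matchingAt η τ ω t)).card

end MatchingBandit

end

/-!
A matching formed from the requests `A` is stable exactly when every player's request is already
its *best response*: the best arm that it obtains if everybody else repeats its request. CA-UCB
aims at the best response. OCA-UCB fails to select it for one of two reasons: the selected arm is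
not obtainable (the player is *exploring*), or it is obtainable but the confidence bounds rank it
above a better one (the player is *misled*).

In each round, whatever the past, every pattern of delays has probability at least
`ε = min(λ, 1 - λ) ^ N`; in particular a given player may be the only one that is not delayed.
This gives three nonnegative supermartingales with respect to the delays
(`IsDelaySupermartingale`).

* An exploring player that moves alone loses to the holder of the arm and refutes one of its
  finitely many beliefs. Hence the expected number of explorations is finite
  (`ae_exploring_bounded`), which is the first assertion.
* A misled player that moves alone obtains the arm. By the strong law of large numbers, the
  confidence bounds misrank two arms in late rounds only while the worse one has been pulled
  `O(log t)` times (`eventually_pulls_le`); no concentration inequality is needed for an almost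
  sure bound, because the confidence radius at each fixed number of pulls grows with the round.
  So there are `O(log T)` misled pulls (`exists_misledPull_le`), and by Markov's inequality and
  the Borel–Cantelli lemma for an exponential supermartingale also `O(log T)` misled selections.
* From any requests, best responses of single players lead to stability
  (`exists_stable_reachable`): first the players that hold an arm move, and all requests improve
  for the players; when the holders are content, the others move, the holders stay content, and
  all arms improve their partners. The number of moves that remain defines a potential
  (`exists_potential`) that turns the number of unstable rounds, with a penalty for each round
  with an error, into an exponential supermartingale. As stable matchings persist while there are
  no errors, there are `O(log T)` unstable rounds (`exists_unstableRounds_le`).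

The last assertion follows by dominated convergence.
-/

noncomputable section

namespace MatchingBandit

open scoped Classical

/-! ### Matchings formed from requests -/

section Matching

variable {N K : ℕ} {η : Fin K → Fin N → ℝ} {μ : Fin N → Fin K → ℝ} {A : Fin N → Fin K}

lemma resolve_eq_some {i : Fin N} {a : Fin K} :
    resolve η A i = some a ↔ A i = a ∧ ∀ k, k ≠ i → A k = a → η a k < η a i := by
  unfold resolve
  split_ifs with h
  · simp only [Option.some.injEq]
    constructor
    · rintro rfl; exact ⟨rfl, h⟩
    · exact fun h => h.1
  · simp only [false_iff]
    rintro ⟨rfl, h'⟩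
    exact h h'

lemma resolve_unique {i k : Fin N} {a : Fin K} (hi : resolve η A i = some a)
    (hk : resolve η A k = some a) : i = k := by
  rw [resolve_eq_some] at hi hk
  by_contra h
  exact lt_asymm (hi.2 k (Ne.symm h) hk.1) (hk.2 i h hi.1)

lemma exists_resolve_eq (hη : ∀ a, Function.Injective (η a)) (k : Fin N) :
    ∃ h, resolve η A h = some (A k) ∧ η (A k) k ≤ η (A k) h := by
  obtain ⟨h, hh, hmax⟩ := Finset.exists_max_image (Finset.univ.filter fun j => A j = A k)
    (η (A k)) ⟨k, by simp⟩
  simp only [Finset.mem_filter, Finset.mem_univ, true_and] at hh hmax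
  exact ⟨h, resolve_eq_some.2 ⟨hh, fun j hj hjk =>
    lt_of_le_of_ne (hmax j hjk) fun e => hj (hη _ e)⟩, hmax k rfl⟩

lemma exists_unheld (hNK : N ≤ K) {i : Fin N} (hi : ∀ a, resolve η A i ≠ some a) :
    ∃ a, ∀ k, resolve η A k ≠ some a := by
  by_contra! h
  choose g hg using h
  have hinj : Function.Injective g := fun a b hab => by
    have := hg a
    rw [hab, hg b] at this
    exact (Option.some.inj this).symm
  have hcard : K = N := le_antisymm (by simpa using Fintype.card_le_of_injective g hinj) hNK
  subst hcard
  obtain ⟨a, ha⟩ := (Finite.injective_iff_surjective.1 hinj) i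
  exact hi a (ha ▸ hg a)

/-- The arms that player `i` obtains when it requests them while everybody else repeats the
request recorded in `A`: `caPlausible`, as a function of the requests alone. -/
def openArms (η : Fin K → Fin N → ℝ) (A : Fin N → Fin K) (i : Fin N) : Finset (Fin K) :=
  Finset.univ.filter fun a => ∀ k, resolve η A k = some a → k ≠ i → η a k < η a i

lemma mem_openArms {i : Fin N} {a : Fin K} :
    a ∈ openArms η A i ↔ ∀ k, resolve η A k = some a → k ≠ i → η a k < η a i := by
  simp [openArms]

lemma mem_openArms_of_resolve {i : Fin N} {a : Fin K} (h : resolve η A i = some a) :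
    a ∈ openArms η A i :=
  mem_openArms.2 fun _ hk hki => absurd (resolve_unique hk h) hki

lemma openArms_nonempty (hNK : N ≤ K) (i : Fin N) : (openArms η A i).Nonempty := by
  by_cases h : ∃ a, resolve η A i = some a
  · obtain ⟨a, ha⟩ := h
    exact ⟨a, mem_openArms_of_resolve ha⟩
  · push Not at h
    obtain ⟨a, ha⟩ := exists_unheld hNK h
    exact ⟨a, mem_openArms.2 fun k hk => absurd hk (ha k)⟩

lemma mem_openArms_self_iff (hη : ∀ a, Function.Injective (η a)) {i : Fin N} :
    A i ∈ openArms η A i ↔ resolve η A i = some (A i) := by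
  refine ⟨fun h => ?_, mem_openArms_of_resolve⟩
  obtain ⟨k, hk, hik⟩ := exists_resolve_eq (A := A) hη i
  by_cases hki : k = i
  · exact hki ▸ hk
  · exact absurd (mem_openArms.1 h k hk hki) (not_lt.2 hik)

/-- The request that is best for `i` if everybody else repeats the request recorded in `A`
(a placeholder if there is no open arm, which does not happen when `N ≤ K`). -/
def bestResponse (μ : Fin N → Fin K → ℝ) (η : Fin K → Fin N → ℝ) (A : Fin N → Fin K)
    (i : Fin N) : Fin K :=
  if h : (openArms η A i).Nonempty then
    (Finset.exists_max_image (openArms η A i) (μ i) h).choose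
  else A i

lemma bestResponse_spec (hNK : N ≤ K) (i : Fin N) :
    bestResponse μ η A i ∈ openArms η A i ∧
      ∀ b ∈ openArms η A i, μ i b ≤ μ i (bestResponse μ η A i) := by
  have h := openArms_nonempty (η := η) (A := A) hNK i
  unfold bestResponse
  rw [dif_pos h]
  exact (Finset.exists_max_image (openArms η A i) (μ i) h).choose_spec

lemma bestResponse_eq_iff (hNK : N ≤ K) (hμ : ∀ i, Function.Injective (μ i)) {i : Fin N}
    {a : Fin K} : bestResponse μ η A i = a ↔
      a ∈ openArms η A i ∧ ∀ b ∈ openArms η A i, μ i b ≤ μ i a := by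
  have hs := bestResponse_spec (μ := μ) (η := η) (A := A) hNK i
  constructor
  · rintro rfl; exact hs
  · rintro ⟨h1, h2⟩
    exact hμ i (le_antisymm (h2 _ hs.1) (hs.2 _ h1))

/-- The matching is stable exactly when no player gains by changing its request unilaterally. -/
lemma isStable_resolve_iff (hNK : N ≤ K) (hμ : ∀ i, Function.Injective (μ i))
    (hη : ∀ a, Function.Injective (η a)) :
    IsStable μ η (resolve η A) ↔ ∀ i, bestResponse μ η A i = A i := by
  constructor
  · rintro ⟨-, hb⟩ i
    obtain ⟨h1, h2⟩ := bestResponse_spec (μ := μ) (η := η) (A := A) hNK i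
    by_contra hne
    refine hb ⟨i, bestResponse μ η A i, fun b hb' => ?_, fun k hk => mem_openArms.1 h1 k hk ?_⟩
    · have hAb := (resolve_eq_some.1 hb').1
      refine lt_of_le_of_ne (h2 b (mem_openArms_of_resolve hb')) fun e => hne ?_
      rw [hAb, hμ i e]
    · rintro rfl
      exact hne (resolve_eq_some.1 hk).1.symm
  · intro h
    refine ⟨fun i k a => resolve_unique, ?_⟩
    rintro ⟨i, a, hp, ha⟩
    obtain ⟨h1, h2⟩ := (bestResponse_eq_iff hNK hμ).1 (h i)
    have hm := (mem_openArms_self_iff hη).1 h1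
    exact absurd (hp _ hm) (not_lt.2 (h2 a (mem_openArms.2 fun k hk _ => ha k hk)))

/-- A player that alone changes its request, to an open arm, obtains it. -/
lemma resolve_update_self (hη : ∀ a, Function.Injective (η a)) {i : Fin N} {a : Fin K}
    (ha : a ∈ openArms η A i) : resolve η (Function.update A i a) i = some a := by
  refine resolve_eq_some.2 ⟨by simp, fun k hk hka => ?_⟩
  rw [Function.update_of_ne hk] at hka
  obtain ⟨h, hh, hkh⟩ := exists_resolve_eq (A := A) hη k
  rw [hka] at hh hkh
  by_cases hhi : h = i
  · subst hhi
    exact lt_of_le_of_ne hkh fun e => hk (hη _ e)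
  · exact lt_of_le_of_lt hkh (mem_openArms.1 ha h hh hhi)

/-- A player that alone changes its request, to an arm that is not open, loses to its holder. -/
lemma exists_holder_of_notMem_openArms (hη : ∀ a, Function.Injective (η a)) {i : Fin N}
    {a : Fin K} (ha : a ∉ openArms η A i) :
    ∃ k, k ≠ i ∧ resolve η A k = some a ∧ resolve η (Function.update A i a) k = some a := by
  simp only [mem_openArms, not_forall] at ha
  obtain ⟨k, hk, hki, hlt⟩ := ha
  refine ⟨k, hki, hk, ?_⟩
  obtain ⟨h1, h2⟩ := resolve_eq_some.1 hk
  refine resolve_eq_some.2 ⟨by rw [Function.update_of_ne hki, h1], fun j hj hja => ?_⟩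
  by_cases hji : j = i
  · subst hji
    exact lt_of_le_of_ne (not_lt.1 hlt) fun e => hj (hη _ e)
  · rw [Function.update_of_ne hji] at hja
    exact h2 j hj hja

/-! ### Best responses lead to stability -/

/-- One player switches to its best response, the others repeat their requests. -/
def Move (μ : Fin N → Fin K → ℝ) (η : Fin K → Fin N → ℝ) (A B : Fin N → Fin K) : Prop :=
  ∃ i, B = Function.update A i (bestResponse μ η A i)

/-- No player that holds an arm wants to change its request. -/
def HoldersContent (μ : Fin N → Fin K → ℝ) (η : Fin K → Fin N → ℝ) (A : Fin N → Fin K) : Prop :=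
  ∀ i, resolve η A i = some (A i) → bestResponse μ η A i = A i

/-- If players without an arm keep their requests and holders move, all requests improve in the
eyes of the players, so the holders become content after finitely many moves. -/
lemma exists_holdersContent (hNK : N ≤ K) (hμ : ∀ i, Function.Injective (μ i))
    (A : Fin N → Fin K) :
    ∃ B, Relation.ReflTransGen (Move μ η) A B ∧ HoldersContent μ η B := by
  obtain ⟨B, hB, hmax⟩ := Set.exists_max_image {B | Relation.ReflTransGen (Move μ η) A B}
    (fun B => ∑ j, μ j (B j)) (Set.toFinite _) ⟨A, Relation.ReflTransGen.refl⟩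
  refine ⟨B, hB, fun i hi => ?_⟩
  by_contra hne
  refine absurd (hmax _ (Relation.ReflTransGen.tail hB ⟨i, rfl⟩)) (not_le.2 ?_)
  have hlt : μ i (B i) < μ i (bestResponse μ η B i) :=
    lt_of_le_of_ne ((bestResponse_spec hNK i).2 _ (mem_openArms_of_resolve hi))
      fun e => hne (hμ i e).symm
  refine Finset.sum_lt_sum (fun j _ => ?_) ⟨i, Finset.mem_univ i, by simpa using hlt⟩
  by_cases hj : j = i
  · subst hj; simpa using hlt.le
  · simp [Function.update_of_ne hj]

lemma resolve_update_of_unmatched (hη : ∀ a, Function.Injective (η a)) {i j : Fin N}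
    {a b : Fin K} (hi : resolve η A i ≠ some (A i)) (hab : b ≠ a) :
    resolve η (Function.update A i a) j = some b ↔ resolve η A j = some b := by
  have hi' : ∀ c, resolve η A i ≠ some c := fun c hc =>
    hi ((resolve_eq_some.1 hc).1 ▸ hc)
  constructor
  · intro h
    obtain ⟨h1, h2⟩ := resolve_eq_some.1 h
    have hji : j ≠ i := by
      rintro rfl
      exact hab (by simpa using h1.symm)
    rw [Function.update_of_ne hji] at h1
    obtain ⟨k, hk, hjk⟩ := exists_resolve_eq (A := A) hη j
    rw [h1] at hk hjk
    by_cases hkj : k = j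
    · exact hkj ▸ hk
    · have hki : k ≠ i := fun e => hi' b (e ▸ hk)
      have := h2 k hkj (by rw [Function.update_of_ne hki, (resolve_eq_some.1 hk).1])
      exact absurd this (not_lt.2 hjk)
  · intro h
    obtain ⟨h1, h2⟩ := resolve_eq_some.1 h
    have hji : j ≠ i := fun e => hi' b (e ▸ h)
    refine resolve_eq_some.2 ⟨by rw [Function.update_of_ne hji, h1], fun k hk hkb => ?_⟩
    by_cases hki : k = i
    · subst hki
      exact absurd (by simpa using hkb.symm) hab
    · rw [Function.update_of_ne hki] at hkb
      exact h2 k hk hkb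

/-- When a player without an arm moves, every arm's partner improves or stays, so there are
fewer open arms. -/
lemma armWants_of_update (hη : ∀ a, Function.Injective (η a)) {i j : Fin N}
    {a b : Fin K} (hi : resolve η A i ≠ some (A i)) (ha : a ∈ openArms η A i)
    (h : ∀ k, resolve η (Function.update A i a) k = some b → k ≠ j → η b k < η b j) :
    ∀ k, resolve η A k = some b → k ≠ j → η b k < η b j := by
  intro k hk hkj
  by_cases hb : b = a
  · subst hb
    have hki : k ≠ i := by
      rintro rfl
      exact hi ((resolve_eq_some.1 hk).1 ▸ hk)
    have h1 := mem_openArms.1 ha k hk hki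
    by_cases hij : i = j
    · exact hij ▸ h1
    · exact h1.trans (h i (resolve_update_self hη ha) hij)
  · exact h k ((resolve_update_of_unmatched hη hi hb).2 hk) hkj

lemma HoldersContent.update (hNK : N ≤ K) (hμ : ∀ i, Function.Injective (μ i))
    (hη : ∀ a, Function.Injective (η a)) {i : Fin N} (hA : HoldersContent μ η A)
    (hi : resolve η A i ≠ some (A i)) :
    HoldersContent μ η (Function.update A i (bestResponse μ η A i)) := by
  obtain ⟨h1, h2⟩ := bestResponse_spec (μ := μ) (η := η) (A := A) hNK i
  intro j hj
  refine (bestResponse_eq_iff hNK hμ).2 ⟨mem_openArms_of_resolve hj, fun b hb => ?_⟩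
  have hb' : b ∈ openArms η A j :=
    mem_openArms.2 (armWants_of_update hη hi h1 (mem_openArms.1 hb))
  by_cases hji : j = i
  · subst hji
    simpa using h2 b hb'
  · rw [Function.update_of_ne hji] at hj ⊢
    have hne : A j ≠ bestResponse μ η A i := fun e =>
      hji (resolve_unique (e ▸ hj) (resolve_update_self hη h1))
    rw [resolve_update_of_unmatched hη hi hne] at hj
    exact ((bestResponse_eq_iff hNK hμ).1 (hA j hj)).2 b hb'

/-- Best responses lead from all requests to a stable matching: first the holders move, then the
players without an arm, whose moves keep the holders content and improve the arms' partners. -/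
lemma exists_stable_reachable (hNK : N ≤ K) (hμ : ∀ i, Function.Injective (μ i))
    (hη : ∀ a, Function.Injective (η a)) (A : Fin N → Fin K) :
    ∃ B, Relation.ReflTransGen (Move μ η) A B ∧ ∀ i, bestResponse μ η B i = B i := by
  obtain ⟨A', hA', hc'⟩ := exists_holdersContent (η := η) hNK hμ A
  obtain ⟨B, ⟨hB, hc⟩, hmin⟩ := Set.exists_min_image
    {B | Relation.ReflTransGen (Move μ η) A B ∧ HoldersContent μ η B}
    (fun B => (Finset.univ.filter fun p : Fin N × Fin K =>
      ArmWants η (resolve η B) p.1 p.2).card) (Set.toFinite _) ⟨A', hA', hc'⟩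
  refine ⟨B, hB, fun i => ?_⟩
  by_contra hne
  have hi : resolve η B i ≠ some (B i) := fun h => hne (hc i h)
  obtain ⟨h1, h2⟩ := bestResponse_spec (μ := μ) (η := η) (A := B) hNK i
  refine absurd (hmin _ ⟨hB.tail ⟨i, rfl⟩, hc.update hNK hμ hη hi⟩) (not_le.2 ?_)
  have hwin := resolve_update_self hη h1
  refine Finset.card_lt_card (Finset.ssubset_iff_of_subset ?_ |>.2
    ⟨(i, bestResponse μ η B i), ?_, ?_⟩)
  · rintro ⟨j, b⟩ hp
    simp only [Finset.mem_filter, Finset.mem_univ, true_and] at hp ⊢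
    intro k hk
    by_cases hkj : k = j
    · -- the holder `j` of `b` does not block: after the move `b` has the same or a better partner
      subst hkj
      by_cases hb : b = bestResponse μ η B i
      · subst hb
        have hki : k ≠ i := fun e => hi (by rw [e] at hk; rw [(resolve_eq_some.1 hk).1]; exact hk)
        exact absurd (hp i hwin) (lt_asymm (mem_openArms.1 h1 k hk hki))
      · exact hp k ((resolve_update_of_unmatched hη hi hb).2 hk)
    · exact armWants_of_update hη hi h1 (fun k hk _ => hp k hk) k hk hkj
  · simp only [Finset.mem_filter, Finset.mem_univ, true_and]
    refine fun k hk => mem_openArms.1 h1 k hk ?_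
    rintro rfl
    exact hne (resolve_eq_some.1 hk).1.symm
  · simp only [Finset.mem_filter, Finset.mem_univ, true_and]
    exact fun h => lt_irrefl _ (h i hwin)

/-- `StableWithin n A`: at most `n` best responses lead from `A` to a stable matching. -/
def StableWithin (μ : Fin N → Fin K → ℝ) (η : Fin K → Fin N → ℝ) : ℕ → (Fin N → Fin K) → Prop
  | 0, A => ∀ i, bestResponse μ η A i = A i
  | n + 1, A => (∀ i, bestResponse μ η A i = A i) ∨
      ∃ i, StableWithin μ η n (Function.update A i (bestResponse μ η A i))

lemma exists_stableWithin (hNK : N ≤ K) (hμ : ∀ i, Function.Injective (μ i))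
    (hη : ∀ a, Function.Injective (η a)) (A : Fin N → Fin K) : ∃ n, StableWithin μ η n A := by
  obtain ⟨B, hAB, hB⟩ := exists_stable_reachable hNK hμ hη A
  induction hAB using Relation.ReflTransGen.head_induction_on with
  | refl => exact ⟨0, hB⟩
  | head h _ ih =>
    obtain ⟨i, rfl⟩ := h
    obtain ⟨n, hn⟩ := ih
    exact ⟨n + 1, Or.inr ⟨i, hn⟩⟩

/-- A potential on requests with a uniform expected decrease, as long as the matching is not
stable, in a market that makes every best-response move with probability at least `ε`.
With `d` the distance to stability it is `1 - (ε / 2) ^ d / 2`. -/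
lemma exists_potential (hNK : N ≤ K) (hμ : ∀ i, Function.Injective (μ i))
    (hη : ∀ a, Function.Injective (η a)) {ε : ℝ} (hε0 : 0 < ε) (hε1 : ε ≤ 1) :
    ∃ (ψ : (Fin N → Fin K) → ℝ) (ρ : ℝ), 0 < ρ ∧ ρ < 1 ∧ (∀ A, 1 / 2 ≤ ψ A ∧ ψ A ≤ 1) ∧
      ∀ A, ¬ (∀ i, bestResponse μ η A i = A i) →
        ∃ i, 1 - ε * (1 - ψ (Function.update A i (bestResponse μ η A i))) ≤ ρ * ψ A := by
  have hex := exists_stableWithin hNK hμ hη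
  let d : (Fin N → Fin K) → ℕ := fun A => Nat.find (hex A)
  obtain ⟨L, hL⟩ : ∃ L, ∀ A, d A ≤ L := by
    obtain ⟨L, hL⟩ := (Set.finite_range d).bddAbove
    exact ⟨L, fun A => hL ⟨A, rfl⟩⟩
  have hq0 : 0 < ε / 2 := by positivity
  have hq1 : ε / 2 ≤ 1 := by linarith
  have hpos : ∀ n, 0 < (ε / 2) ^ n := fun n => pow_pos hq0 n
  have hle : ∀ n, (ε / 2) ^ n ≤ 1 := fun n => pow_le_one₀ hq0.le hq1
  refine ⟨fun A => 1 - (ε / 2) ^ d A / 2, 1 - (ε / 2) ^ L / 2, ?_, ?_, fun A => ⟨?_, ?_⟩,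
    fun A hA => ?_⟩
  · linarith [hle L]
  · linarith [hpos L]
  · linarith [hle (d A)]
  · linarith [hpos (d A)]
  · have hspec : StableWithin μ η (d A) A := Nat.find_spec (hex A)
    rcases hd : d A with _ | k
    · rw [hd] at hspec
      exact absurd hspec hA
    · rw [hd] at hspec
      obtain ⟨i, hi⟩ := hspec.resolve_left hA
      refine ⟨i, ?_⟩
      have hdk : d (Function.update A i (bestResponse μ η A i)) ≤ k := Nat.find_min' (hex _) hi
      have h1 : (ε / 2) ^ k ≤ (ε / 2) ^ d (Function.update A i (bestResponse μ η A i)) :=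
        pow_le_pow_of_le_one hq0.le hq1 hdk
      have h2 : (ε / 2) ^ L ≤ (ε / 2) ^ (k + 1) :=
        pow_le_pow_of_le_one hq0.le hq1 (hd ▸ hL A)
      have h3 : ε * (ε / 2) ^ k ≤ ε * (ε / 2) ^ d (Function.update A i (bestResponse μ η A i)) :=
        mul_le_mul_of_nonneg_left h1 hε0.le
      have h4 : (ε / 2) ^ (k + 1) = ε * (ε / 2) ^ k / 2 := by ring
      have h5 := hpos L
      have h6 := hle (k + 1)
      -- `1 - x ≤ (1 - x / 2) ^ 2` for `x = (ε / 2) ^ (k + 1)`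
      simp only [hd]
      nlinarith [mul_pos h5 (hpos (k + 1))]

end Matching

section Probability

variable {N K : ℕ} {η : Fin K → Fin N → ℝ} {μ : Fin N → Fin K → ℝ} {τ : TieBreak N K}
  {lam : unitInterval}

/-! ### Resampling the delays of a round -/

/-- The law of the delays of all players in a single round. -/
def rowLaw (N : ℕ) (lam : unitInterval) : Measure (Fin N → Bool) :=
  Measure.infinitePi fun _ => bernoulliMeasure true false lam

instance : IsProbabilityMeasure (rowLaw N lam) := by unfold rowLaw; infer_instance

lemma sum_rowLaw : ∑ S, (rowLaw N lam).real {S} = 1 := by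
  rw [sum_measureReal_singleton, Finset.coe_univ, probReal_univ]

lemma le_rowLaw (S : Fin N → Bool) :
    min (lam : ℝ) (1 - lam) ^ N ≤ (rowLaw N lam).real {S} := by
  have h : (rowLaw N lam).real {S} = ∏ i, (bernoulliMeasure true false lam).real {S i} := by
    rw [rowLaw, measureReal_def, Measure.infinitePi_singleton_of_fintype, ENNReal.toReal_prod]
    rfl
  rw [h]
  calc min (lam : ℝ) (1 - lam) ^ N = ∏ _i : Fin N, min (lam : ℝ) (1 - lam) := by simp
    _ ≤ _ := Finset.prod_le_prod
      (fun i _ => le_min lam.2.1 (sub_nonneg.2 lam.2.2)) fun i _ => ?_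
  rw [bernoulliMeasure_real_apply _ (MeasurableSet.singleton _)]
  rcases S i with _ | _ <;> simp

lemma measurePreserving_resample (t : ℕ) :
    MeasurePreserving (fun (p : (ℕ × Fin N → Bool) × (Fin N → Bool)) (x : ℕ × Fin N) =>
        if x.1 = t then p.2 x.2 else p.1 x)
      ((Measure.infinitePi fun _ : ℕ × Fin N => bernoulliMeasure true false lam).prod
        (rowLaw N lam))
      (Measure.infinitePi fun _ : ℕ × Fin N => bernoulliMeasure true false lam) := by
  have hm : Measurable (fun (p : (ℕ × Fin N → Bool) × (Fin N → Bool)) (x : ℕ × Fin N) =>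
      if x.1 = t then p.2 x.2 else p.1 x) := by
    refine measurable_pi_iff.2 fun x => ?_
    by_cases h : x.1 = t
    · simp only [h, if_true]; fun_prop
    · simp only [h, if_false]; fun_prop
  refine ⟨hm, Measure.eq_infinitePi _ fun s B hB => ?_⟩
  rw [Measure.map_apply hm (MeasurableSet.pi s.countable_toSet fun i _ => hB i)]
  have hpre : (fun (p : (ℕ × Fin N → Bool) × (Fin N → Bool)) (x : ℕ × Fin N) =>
      if x.1 = t then p.2 x.2 else p.1 x) ⁻¹' Set.pi s B =
      Set.pi (s.filter fun x => ¬ x.1 = t : Finset _) B ×ˢ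
        Set.pi ((s.filter fun x => x.1 = t).image Prod.snd : Finset _) fun i => B (t, i) := by
    ext ⟨d, S⟩
    simp only [Set.mem_preimage, Set.mem_pi, Set.mem_prod, Finset.coe_filter, Finset.coe_image,
      Set.mem_ofPred_eq, Set.mem_image, SetLike.mem_coe]
    constructor
    · refine fun h => ⟨fun x hx => by simpa [hx.2] using h x hx.1, ?_⟩
      rintro i ⟨⟨u, j⟩, ⟨hx, rfl⟩, rfl⟩
      simpa using h _ hx
    · rintro ⟨h1, h2⟩ ⟨u, j⟩ hx
      by_cases hu : u = t
      · subst hu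
        simpa using h2 j ⟨(u, j), ⟨hx, rfl⟩, rfl⟩
      · simpa [hu] using h1 (u, j) ⟨hx, hu⟩
  rw [hpre, Measure.prod_prod, rowLaw, Measure.infinitePi_pi _ fun i _ => hB i,
    Measure.infinitePi_pi _ fun i _ => hB _, Finset.prod_image, mul_comm,
    ← Finset.prod_filter_mul_prod_filter_not s (fun x => x.1 = t)]
  · congr 1
    refine Finset.prod_congr rfl fun x hx => ?_
    rw [← (Finset.mem_filter.1 hx).2]
  · rintro ⟨u, j⟩ hx ⟨v, k⟩ hy h
    simp only [Finset.coe_filter, Set.mem_ofPred_eq] at hx hy h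
    rw [hx.2, hy.2, h]

/-- The sample `ω` with the delays of round `t` replaced by `S`. -/
def setRow (ω : Sample N K) (t : ℕ) (S : Fin N → Bool) : Sample N K :=
  (ω.1, fun x => if x.1 = t then S x.2 else ω.2.1 x, ω.2.2)

lemma measurable_setRow (t : ℕ) (S : Fin N → Bool) :
    Measurable fun ω : Sample N K => setRow ω t S := by
  refine measurable_fst.prodMk (Measurable.prodMk ?_ (by fun_prop))
  refine measurable_pi_iff.2 fun x => ?_
  by_cases h : x.1 = t
  · simp only [h, if_true]; fun_prop
  · simp only [h, if_false]; fun_prop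

lemma isProbabilityMeasure_uniformOn (hNK : N ≤ K) (i : Fin N) :
    IsProbabilityMeasure (uniformOn (Set.univ : Set (Fin K))) := by
  have : Nonempty (Fin K) := ⟨Fin.castLE hNK i⟩
  exact ProbabilityTheory.isProbabilityMeasure_uniformOn Set.finite_univ Set.univ_nonempty

lemma isProbabilityMeasure_law (hNK : N ≤ K) : IsProbabilityMeasure (law (N := N) lam μ) := by
  have := fun i : Fin N => isProbabilityMeasure_uniformOn hNK i
  unfold law
  infer_instance

/-- The delays of a round are independent of everything else. -/
lemma lintegral_law_eq_sum_setRow (hNK : N ≤ K) (t : ℕ) {f : Sample N K → ENNReal}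
    (hf : Measurable f) :
    ∫⁻ ω, f ω ∂(law lam μ) =
      ∫⁻ ω, ∑ S, f (setRow ω t S) * (rowLaw N lam) {S} ∂(law lam μ) := by
  have := fun i : Fin N => isProbabilityMeasure_uniformOn hNK i
  have hg : Measurable fun ω : Sample N K =>
      ∑ S, f (setRow ω t S) * (rowLaw N lam) {S} :=
    Finset.measurable_sum _ fun S _ => (hf.comp (measurable_setRow t S)).mul_const _
  unfold law
  rw [lintegral_prod _ hf.aemeasurable, lintegral_prod _ hg.aemeasurable]
  refine lintegral_congr fun x => ?_
  have hfx : Measurable fun y => f (x, y) := hf.comp measurable_prodMk_left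
  have hgx : Measurable fun y : (ℕ × Fin N → Bool) × (Fin N × Fin K × ℕ → ℝ) =>
      ∑ S, f (setRow (x, y) t S) * (rowLaw N lam) {S} := hg.comp measurable_prodMk_left
  rw [lintegral_prod_symm' _ hfx, lintegral_prod_symm' _ hgx]
  refine lintegral_congr fun r => ?_
  have hfr : Measurable fun d => f (x, d, r) := hfx.comp measurable_prodMk_right
  rw [← (measurePreserving_resample (lam := lam) t).lintegral_comp hfr,
    lintegral_prod (fun p : (ℕ × Fin N → Bool) × (Fin N → Bool) =>
      f (x, (fun y => if y.1 = t then p.2 y.2 else p.1 y), r))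
      (hfr.comp (measurePreserving_resample (lam := lam) t).measurable).aemeasurable]
  exact lintegral_congr fun d => lintegral_fintype _

/-- A nonnegative process that does not increase in expectation when the delays of the next round
are drawn afresh. -/
structure IsDelaySupermartingale (lam : unitInterval) (Z : ℕ → Sample N K → ℝ) : Prop where
  measurable : ∀ t, Measurable (Z t)
  nonneg : ∀ t ω, 0 ≤ Z t ω
  drift : ∀ t ≥ 1, ∀ ω, ∑ S, (rowLaw N lam).real {S} * Z (t + 1) (setRow ω (t + 1) S) ≤ Z t ω

lemma IsDelaySupermartingale.lintegral_le (hNK : N ≤ K) {Z : ℕ → Sample N K → ℝ}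
    (hZ : IsDelaySupermartingale lam Z) {b : ℝ} (hb : ∀ ω, Z 1 ω ≤ b) (t : ℕ) :
    ∫⁻ ω, ENNReal.ofReal (Z (t + 1) ω) ∂(law lam μ) ≤ ENNReal.ofReal b := by
  have := isProbabilityMeasure_law (lam := lam) (μ := μ) hNK
  induction t with
  | zero =>
    calc _ ≤ ∫⁻ _, ENNReal.ofReal b ∂(law lam μ) :=
          lintegral_mono fun ω => ENNReal.ofReal_le_ofReal (hb ω)
      _ = _ := by simp
  | succ t ih =>
    refine le_trans ?_ ih
    rw [lintegral_law_eq_sum_setRow hNK (t + 1 + 1) (hZ.measurable _).ennreal_ofReal]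
    refine lintegral_mono fun ω => ?_
    refine le_trans (le_of_eq ?_) (ENNReal.ofReal_le_ofReal (hZ.drift (t + 1) (by omega) ω))
    rw [ENNReal.ofReal_sum_of_nonneg fun S _ => mul_nonneg measureReal_nonneg (hZ.nonneg _ _)]
    refine Finset.sum_congr rfl fun S _ => ?_
    rw [mul_comm, ENNReal.ofReal_mul measureReal_nonneg, ofReal_measureReal]

/-- By Markov's inequality and the Borel–Cantelli lemma. -/
lemma IsDelaySupermartingale.ae_eventually_le_sq (hNK : N ≤ K) {Z : ℕ → Sample N K → ℝ}
    (hZ : IsDelaySupermartingale lam Z) {b : ℝ} (hb : ∀ ω, Z 1 ω ≤ b) :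
    ∀ᵐ ω ∂(law lam μ), ∀ᶠ T : ℕ in atTop, Z T ω ≤ (T : ℝ) ^ 2 := by
  have hle : ∀ t : ℕ, law lam μ {ω | ((t + 1 : ℕ) : ℝ) ^ 2 ≤ Z (t + 1) ω} ≤
      ENNReal.ofReal (b * (1 / ((t + 1 : ℕ) : ℝ) ^ 2)) := fun t => by
    have hpos : 0 < ((t + 1 : ℕ) : ℝ) ^ 2 := by positivity
    have h := mul_meas_ge_le_lintegral (μ := law lam μ) (hZ.measurable (t + 1)).ennreal_ofReal
      (ENNReal.ofReal (((t + 1 : ℕ) : ℝ) ^ 2))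
    have h' := h.trans (hZ.lintegral_le hNK hb t)
    rw [mul_one_div, ENNReal.ofReal_div_of_pos hpos,
      ENNReal.le_div_iff_mul_le (Or.inl (ENNReal.ofReal_pos.2 hpos).ne')
        (Or.inl ENNReal.ofReal_ne_top), mul_comm]
    refine le_trans (mul_le_mul_right (measure_mono fun ω hω => ?_) _) h'
    exact ENNReal.ofReal_le_ofReal hω
  have hsum : ∑' t : ℕ, law lam μ {ω | ((t + 1 : ℕ) : ℝ) ^ 2 ≤ Z (t + 1) ω} ≠ ⊤ := by
    refine ne_top_of_le_ne_top ?_ (ENNReal.tsum_le_tsum hle)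
    refine Summable.tsum_ofReal_ne_top (Summable.mul_left _ ?_)
    exact (summable_nat_add_iff 1).2 (Real.summable_one_div_nat_pow.2 one_lt_two)
  filter_upwards [ae_eventually_notMem hsum] with ω hω
  obtain ⟨t, ht⟩ := eventually_atTop.1 hω
  refine eventually_atTop.2 ⟨t + 1, fun T hT => ?_⟩
  obtain ⟨m, rfl⟩ := Nat.exists_eq_add_of_le' (show 1 ≤ T by omega)
  exact (not_le.1 (ht m (by omega))).le

/-- A counter dominated by a supermartingale is bounded, by Fatou's lemma. -/
lemma IsDelaySupermartingale.ae_bounded (hNK : N ≤ K) {Z : ℕ → Sample N K → ℝ}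
    (hZ : IsDelaySupermartingale lam Z) {b : ℝ} (hb : ∀ ω, Z 1 ω ≤ b)
    {M : ℕ → Sample N K → ℕ} (hM : ∀ ω, Monotone fun t => M t ω) {δ : ℝ} (hδ : 0 < δ)
    (hMZ : ∀ t ω, δ * M t ω ≤ Z t ω) :
    ∀ᵐ ω ∂(law lam μ), ∃ B, ∀ t, M t ω ≤ B := by
  have hm : ∀ t, Measurable fun ω => ENNReal.ofReal (Z (t + 1) ω) :=
    fun t => (hZ.measurable _).ennreal_ofReal
  have hfin : ∫⁻ ω, liminf (fun t => ENNReal.ofReal (Z (t + 1) ω)) atTop ∂(law lam μ) ≠ ⊤ := by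
    refine ne_top_of_le_ne_top (b := ENNReal.ofReal b) ENNReal.ofReal_ne_top
      ((lintegral_liminf_le hm).trans ?_)
    refine (liminf_le_liminf (Eventually.of_forall fun t => hZ.lintegral_le hNK hb t)).trans ?_
    simp
  filter_upwards [ae_lt_top (Measurable.liminf hm) hfin] with ω hω
  by_contra! hcon
  have hT : Tendsto (fun t => M t ω) atTop atTop :=
    tendsto_atTop_atTop_of_monotone (hM ω) fun B => (hcon B).imp fun _ h => h.le
  have hT' : Tendsto (fun t => ENNReal.ofReal (Z (t + 1) ω)) atTop (𝓝 ⊤) := by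
    refine ENNReal.tendsto_ofReal_nhds_top.2 ?_
    refine tendsto_atTop_mono (fun t => hMZ (t + 1) ω) ?_
    exact ((tendsto_natCast_atTop_atTop.comp hT).const_mul_atTop hδ).comp (tendsto_add_atTop_nat 1)
  rw [hT'.liminf_eq] at hω
  exact lt_irrefl _ hω

/-- An average over the delays of a round, if one pattern of delays gives at most `u`. -/
lemma sum_rowLaw_mul_le {ε u v : ℝ} (hε : ∀ S, ε ≤ (rowLaw N lam).real {S})
    {f : (Fin N → Bool) → ℝ} (hf : ∀ S, f S ≤ v) (huv : u ≤ v) {S₀ : Fin N → Bool}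
    (hS₀ : f S₀ ≤ u) : ∑ S, (rowLaw N lam).real {S} * f S ≤ v - ε * (v - u) := by
  have h1 : ∑ S, (rowLaw N lam).real {S} * (v - f S) ≥ (rowLaw N lam).real {S₀} * (v - f S₀) :=
    Finset.single_le_sum (f := fun S => (rowLaw N lam).real {S} * (v - f S))
      (fun S _ => mul_nonneg measureReal_nonneg (sub_nonneg.2 (hf S))) (Finset.mem_univ S₀)
  have h2 : ∑ S, (rowLaw N lam).real {S} * (v - f S) =
      v - ∑ S, (rowLaw N lam).real {S} * f S := by
    simp_rw [mul_sub, Finset.sum_sub_distrib, ← Finset.sum_mul, sum_rowLaw, one_mul]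
  have h3 : ε * (v - u) ≤ (rowLaw N lam).real {S₀} * (v - f S₀) :=
    mul_le_mul (hε S₀) (by linarith) (sub_nonneg.2 huv) measureReal_nonneg
  linarith

/-! ### The run as a random process -/

lemma ocaChoice_setRow (ω : Sample N K) (t u : ℕ) (S : Fin N → Bool) (s : State N K) (i : Fin N) :
    ocaChoice η τ (setRow ω u S) t s i = ocaChoice η τ ω t s i := rfl

lemma run_setRow (ω : Sample N K) {t u : ℕ} (h : t < u) (S : Fin N → Bool) :
    run η τ (setRow ω u S) t = run η τ ω t := by
  induction t with
  | zero => rfl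
  | succ t ih =>
    rw [run, run, ih (by omega)]
    congr 1
    funext i
    have hne : t + 1 ≠ u := by omega
    simp [setRow, hne, ← ocaChoice_setRow (η := η) (τ := τ) ω (t + 1) u S]

lemma run_succ_setRow (ω : Sample N K) {t : ℕ} (ht : 1 ≤ t) (S : Fin N → Bool) :
    run η τ (setRow ω (t + 1) S) (t + 1) = (run η τ ω t).next η fun i =>
      if S i = true then (run η τ ω t).attempt i
      else ocaChoice η τ ω (t + 1) (run η τ ω t) i := by
  rw [run, run_setRow ω (Nat.lt_succ_self t)]
  congr 1
  funext i
  simp [setRow, Nat.one_le_iff_ne_zero.1 ht, ← ocaChoice_setRow (η := η) (τ := τ) ω (t + 1) (t + 1) S]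

instance : MeasurableSpace (State N K) := ⊤

instance : DiscreteMeasurableSpace (State N K) := ⟨fun _ => trivial⟩

instance : Countable (State N K) := by
  refine Function.Injective.countable
    (f := fun s : State N K => (s.attempt, s.higher, s.lower, s.pulls)) fun s s' h => ?_
  cases s; cases s'
  simpa using h

lemma measurable_ucb (t : ℕ) (i : Fin N) (a : Fin K) (n : ℕ) :
    Measurable fun ω : Sample N K => ucb ω t i a n := by
  unfold ucb
  split_ifs
  · exact measurable_const
  · refine Measurable.coe_real_ereal (Measurable.add_const (Measurable.div_const ?_ _) _)
    exact Finset.measurable_sum _ fun j _ => by fun_prop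

lemma measurable_ocaChoice (t : ℕ) (s : State N K) (i : Fin N) :
    Measurable fun ω : Sample N K => ocaChoice η τ ω t s i := by
  let : MeasurableSpace (Finset (Fin K)) := ⊤
  have : DiscreteMeasurableSpace (Finset (Fin K)) := ⟨fun _ => trivial⟩
  suffices h : Measurable fun ω : Sample N K => ucbArgmax ω t s i (ocaPlausible η s i) from
    (measurable_of_countable (τ t i)).comp h
  refine measurable_to_countable' fun S => ?_
  have hmem : ∀ a, MeasurableSet
      {ω : Sample N K | a ∈ ucbArgmax ω t s i (ocaPlausible η s i)} := fun a => by
    have h : {ω : Sample N K | a ∈ ucbArgmax ω t s i (ocaPlausible η s i)} =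
        {_ω | a ∈ ocaPlausible η s i} ∩ ⋂ b ∈ ocaPlausible η s i,
          {ω | ucb ω t i b (s.pulls i b) ≤ ucb ω t i a (s.pulls i a)} := by
      ext ω
      simp [ucbArgmax]
    rw [h]
    exact (MeasurableSet.const _).inter (MeasurableSet.iInter fun b => MeasurableSet.iInter fun _ =>
      measurableSet_le (measurable_ucb t i b _) (measurable_ucb t i a _))
  have : (fun ω : Sample N K => ucbArgmax ω t s i (ocaPlausible η s i)) ⁻¹' {S} =
      ⋂ a, {ω | a ∈ ucbArgmax ω t s i (ocaPlausible η s i) ↔ a ∈ S} := by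
    ext ω
    simp [Finset.ext_iff]
  rw [this]
  refine MeasurableSet.iInter fun a => ?_
  by_cases ha : a ∈ S
  · simpa [ha] using hmem a
  · simp only [ha, iff_false]
    exact (hmem a).compl

lemma measurable_of_countable_state {α : Type*} [MeasurableSpace α]
    {f : State N K → Sample N K → α} {g : Sample N K → State N K} (hg : Measurable g)
    (hf : ∀ s, Measurable (f s)) : Measurable fun ω => f (g ω) ω :=
  (measurable_from_prod_countable_right (f := fun p : State N K × Sample N K => f p.1 p.2)
    hf).comp (hg.prodMk measurable_id)

lemma measurable_run (t : ℕ) : Measurable fun ω : Sample N K => run η τ ω t := by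
  induction t with
  | zero =>
    exact (measurable_of_countable fun A : Fin N → Fin K =>
      (⟨A, fun _ _ => ∅, fun i _ => Finset.univ \ {i}, fun _ _ => 0⟩ : State N K)).comp
      measurable_fst
  | succ t ih =>
    simp only [run]
    refine measurable_of_countable_state (f := fun s ω => s.next η fun i =>
      if t = 0 then ω.1 i else if ω.2.1 (t + 1, i) = true then s.attempt i
      else ocaChoice η τ ω (t + 1) s i) ih fun s => ?_
    refine (measurable_of_countable (s.next η)).comp (measurable_pi_iff.2 fun i => ?_)
    refine Measurable.ite (MeasurableSet.const _) (by fun_prop) (Measurable.ite ?_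
      measurable_const (measurable_ocaChoice _ _ _))
    exact (measurable_of_countable (fun b : Bool => b)).comp
      (by fun_prop : Measurable fun ω : Sample N K => ω.2.1 (t + 1, i)) (MeasurableSet.singleton _)

/-- The number of rounds `t` with `1 ≤ t < T` in which `B` holds. -/
def count (B : ℕ → Sample N K → Prop) (T : ℕ) (ω : Sample N K) : ℕ :=
  ((Finset.Ico 1 T).filter fun t => B t ω).card

lemma count_one (B : ℕ → Sample N K → Prop) (ω : Sample N K) : count B 1 ω = 0 := by
  simp [count]

lemma count_succ (B : ℕ → Sample N K → Prop) {T : ℕ} (hT : 1 ≤ T) (ω : Sample N K) :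
    count B (T + 1) ω = count B T ω + if B T ω then 1 else 0 := by
  unfold count
  rw [← Finset.insert_Ico_right_eq_Ico_add_one hT, Finset.filter_insert]
  split_ifs
  · rw [Finset.card_insert_of_notMem (by simp)]
  · rfl

lemma count_mono (B : ℕ → Sample N K → Prop) (ω : Sample N K) :
    Monotone fun T => count B T ω := fun _ _ h =>
  Finset.card_le_card (Finset.filter_subset_filter _ (Finset.Ico_subset_Ico_right h))

lemma measurable_count {B : ℕ → Sample N K → Prop} (hB : ∀ t, MeasurableSet {ω | B t ω}) (T : ℕ) :
    Measurable (count B T) := by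
  have : count B T = fun ω => ∑ t ∈ Finset.Ico 1 T, if B t ω then 1 else 0 := by
    funext ω
    exact Finset.card_filter _ _
  rw [this]
  exact Finset.measurable_sum _ fun t _ => Measurable.ite (hB t) measurable_const measurable_const

lemma count_congr {B B' : ℕ → Sample N K → Prop} {T : ℕ} {ω ω' : Sample N K}
    (h : ∀ t < T, (B t ω ↔ B' t ω')) : count B T ω = count B' T ω' := by
  unfold count
  congr 1
  exact Finset.filter_congr fun t ht => h t (Finset.mem_Ico.1 ht).2

end Probability

section Errors

variable {N K : ℕ} {η : Fin K → Fin N → ℝ} {μ : Fin N → Fin K → ℝ} {τ : TieBreak N K}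
  {lam : unitInterval}

/-! ### Errors of OCA-UCB -/

/-- The arm that OCA-UCB selects for player `i` after round `t`. -/
def choice (η : Fin K → Fin N → ℝ) (τ : TieBreak N K) (i : Fin N) (t : ℕ) (ω : Sample N K) :
    Fin K :=
  ocaChoice η τ ω (t + 1) (run η τ ω t) i

/-- After round `t`, player `i` selects an arm that it cannot obtain from its present holder. -/
def Exploring (η : Fin K → Fin N → ℝ) (τ : TieBreak N K) (i : Fin N) (t : ℕ) (ω : Sample N K) :
    Prop :=
  choice η τ i t ω ∉ openArms η (run η τ ω t).attempt i

/-- After round `t`, player `i` selects an open arm that is not the best one. -/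
def Misled (μ : Fin N → Fin K → ℝ) (η : Fin K → Fin N → ℝ) (τ : TieBreak N K) (i : Fin N) (t : ℕ)
    (ω : Sample N K) : Prop :=
  choice η τ i t ω ∈ openArms η (run η τ ω t).attempt i ∧
    choice η τ i t ω ≠ bestResponse μ η (run η τ ω t).attempt i

/-- After round `t`, some player does not select its best response. -/
def Erring (μ : Fin N → Fin K → ℝ) (η : Fin K → Fin N → ℝ) (τ : TieBreak N K) (t : ℕ)
    (ω : Sample N K) : Prop :=
  ∃ i, choice η τ i t ω ≠ bestResponse μ η (run η τ ω t).attempt i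

/-- Player `i` is misled after round `t` and obtains the arm that it selects. -/
def MisledPull (μ : Fin N → Fin K → ℝ) (η : Fin K → Fin N → ℝ) (τ : TieBreak N K) (i : Fin N)
    (t : ℕ) (ω : Sample N K) : Prop :=
  Misled μ η τ i t ω ∧
    resolve η (run η τ ω (t + 1)).attempt i = some (choice η τ i t ω)

/-- Some player would gain by changing its request of round `t` unilaterally. -/
def Unsettled (μ : Fin N → Fin K → ℝ) (η : Fin K → Fin N → ℝ) (τ : TieBreak N K) (t : ℕ)
    (ω : Sample N K) : Prop :=
  ¬ ∀ i, bestResponse μ η (run η τ ω t).attempt i = (run η τ ω t).attempt i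

lemma measurable_choice (i : Fin N) (t : ℕ) : Measurable (choice η τ i t) :=
  measurable_of_countable_state (f := fun s ω => ocaChoice η τ ω (t + 1) s i) (measurable_run t)
    fun s => measurable_ocaChoice (t + 1) s i

lemma measurableSet_of_choice (i : Fin N) (t u : ℕ) (P : State N K → State N K → Fin K → Prop) :
    MeasurableSet {ω | P (run η τ ω t) (run η τ ω u) (choice η τ i t ω)} := by
  have h : Measurable fun ω => (run η τ ω t, run η τ ω u, choice η τ i t ω) :=
    (measurable_run t).prodMk ((measurable_run u).prodMk (measurable_choice i t))
  exact h (Set.to_countable {p : State N K × State N K × Fin K | P p.1 p.2.1 p.2.2}).measurableSet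

lemma measurableSet_exploring (i : Fin N) (t : ℕ) : MeasurableSet {ω | Exploring η τ i t ω} :=
  measurableSet_of_choice i t t fun s _ a => a ∉ openArms η s.attempt i

lemma measurableSet_misled (i : Fin N) (t : ℕ) : MeasurableSet {ω | Misled μ η τ i t ω} :=
  measurableSet_of_choice i t t fun s _ a =>
    a ∈ openArms η s.attempt i ∧ a ≠ bestResponse μ η s.attempt i

lemma measurableSet_misledPull (i : Fin N) (t : ℕ) : MeasurableSet {ω | MisledPull μ η τ i t ω} :=
  measurableSet_of_choice i t (t + 1) fun s s' a =>
    (a ∈ openArms η s.attempt i ∧ a ≠ bestResponse μ η s.attempt i) ∧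
      resolve η s'.attempt i = some a

lemma measurableSet_erring (t : ℕ) : MeasurableSet {ω | Erring μ η τ t ω} := by
  have : {ω | Erring μ η τ t ω} =
      ⋃ i, {ω | choice η τ i t ω ≠ bestResponse μ η (run η τ ω t).attempt i} := by
    ext ω; simp [Erring]
  rw [this]
  exact MeasurableSet.iUnion fun i =>
    measurableSet_of_choice i t t fun s _ a => a ≠ bestResponse μ η s.attempt i

lemma measurableSet_unsettled (t : ℕ) : MeasurableSet {ω | Unsettled μ η τ t ω} :=
  measurable_run t (MeasurableSet.of_discrete
    (s := {s : State N K | ¬ ∀ i, bestResponse μ η s.attempt i = s.attempt i}))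

lemma choice_setRow (i : Fin N) (ω : Sample N K) {t u : ℕ} (h : t < u) (S : Fin N → Bool) :
    choice η τ i t (setRow ω u S) = choice η τ i t ω := by
  unfold choice
  rw [run_setRow ω h, ocaChoice_setRow]

lemma exploring_setRow (i : Fin N) (ω : Sample N K) {t u : ℕ} (h : t < u) (S : Fin N → Bool) :
    Exploring η τ i t (setRow ω u S) ↔ Exploring η τ i t ω := by
  unfold Exploring
  rw [run_setRow ω h, choice_setRow i ω h]

lemma misled_setRow (i : Fin N) (ω : Sample N K) {t u : ℕ} (h : t < u) (S : Fin N → Bool) :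
    Misled μ η τ i t (setRow ω u S) ↔ Misled μ η τ i t ω := by
  unfold Misled
  rw [run_setRow ω h, choice_setRow i ω h]

lemma erring_setRow (ω : Sample N K) {t u : ℕ} (h : t < u) (S : Fin N → Bool) :
    Erring μ η τ t (setRow ω u S) ↔ Erring μ η τ t ω := by
  unfold Erring
  simp_rw [run_setRow ω h, choice_setRow _ ω h]

lemma unsettled_setRow (ω : Sample N K) {t u : ℕ} (h : t < u) (S : Fin N → Bool) :
    Unsettled μ η τ t (setRow ω u S) ↔ Unsettled μ η τ t ω := by
  unfold Unsettled
  rw [run_setRow ω h]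

lemma misledPull_setRow (i : Fin N) (ω : Sample N K) {t u : ℕ} (h : t + 1 < u)
    (S : Fin N → Bool) : MisledPull μ η τ i t (setRow ω u S) ↔ MisledPull μ η τ i t ω := by
  unfold MisledPull
  rw [misled_setRow i ω (by omega), run_setRow ω h, choice_setRow i ω (by omega)]

lemma attempt_succ_setRow (ω : Sample N K) {t : ℕ} (ht : 1 ≤ t) (S : Fin N → Bool) :
    (run η τ (setRow ω (t + 1) S) (t + 1)).attempt = fun i =>
      if S i = true then (run η τ ω t).attempt i else choice η τ i t ω := by
  rw [run_succ_setRow ω ht]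
  rfl

/-- The delays for which `i` is the only player that is not delayed. -/
def delayOthers (i : Fin N) : Fin N → Bool := fun j => decide (j ≠ i)

lemma attempt_succ_delayOthers (ω : Sample N K) {t : ℕ} (ht : 1 ≤ t) (i : Fin N) :
    (run η τ (setRow ω (t + 1) (delayOthers i)) (t + 1)).attempt =
      Function.update (run η τ ω t).attempt i (choice η τ i t ω) := by
  rw [attempt_succ_setRow ω ht]
  funext j
  by_cases h : j = i
  · subst h; simp [delayOthers]
  · simp [delayOthers, h]

/-! ### Beliefs -/

/-- A belief that is refuted by a lost conflict is wrong. -/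
lemma mem_lower_of_lt (ω : Sample N K) (t : ℕ) {i k : Fin N} {a : Fin K} (hki : k ≠ i)
    (h : η a k < η a i) : k ∈ (run η τ ω t).lower i a := by
  induction t with
  | zero => simp [run, hki]
  | succ t ih =>
    refine Finset.mem_sdiff.2 ⟨ih, fun hmem => ?_⟩
    simp only [lostTo, Finset.mem_filter, Finset.mem_univ, true_and] at hmem
    exact lt_asymm h ((resolve_eq_some.1 hmem.2.2).2 i hki.symm hmem.1)

lemma openArms_subset_ocaPlausible (ω : Sample N K) (t : ℕ) (i : Fin N) :
    openArms η (run η τ ω t).attempt i ⊆ ocaPlausible η (run η τ ω t) i := fun a ha => by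
  simp only [ocaPlausible, Finset.mem_filter, Finset.mem_univ, true_and]
  exact fun k hk hki => mem_lower_of_lt ω t hki (mem_openArms.1 ha k hk hki)

lemma choice_mem_ucbArgmax (hNK : N ≤ K)
    (hτ : ∀ t i (S : Finset (Fin K)), S.Nonempty → τ t i S ∈ S) (ω : Sample N K) (t : ℕ)
    (i : Fin N) : choice η τ i t ω ∈
      ucbArgmax ω (t + 1) (run η τ ω t) i (ocaPlausible η (run η τ ω t) i) := by
  refine hτ _ _ _ ?_
  obtain ⟨a, ha, hmax⟩ := Finset.exists_max_image (ocaPlausible η (run η τ ω t) i)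
    (fun a => ucb ω (t + 1) i a ((run η τ ω t).pulls i a))
    ((openArms_nonempty hNK i).mono (openArms_subset_ocaPlausible ω t i))
  exact ⟨a, Finset.mem_filter.2 ⟨ha, hmax⟩⟩

lemma choice_mem_ucbArgmax_caPlausible (hNK : N ≤ K)
    (hτ : ∀ t i (S : Finset (Fin K)), S.Nonempty → τ t i S ∈ S) (ω : Sample N K) (t : ℕ)
    (i : Fin N) (h : ¬ Exploring η τ i t ω) : choice η τ i t ω ∈
      ucbArgmax ω (t + 1) (run η τ ω t) i (caPlausible η (run η τ ω t) i) := by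
  have hc := Finset.mem_filter.1 (choice_mem_ucbArgmax (η := η) hNK hτ ω t i)
  exact Finset.mem_filter.2 ⟨not_not.1 h, fun b hb =>
    hc.2 b (openArms_subset_ocaPlausible ω t i hb)⟩

/-- The number of beliefs of player `i` that have not been refuted. -/
def optimism (s : State N K) (i : Fin N) : ℕ := ∑ a, (s.lower i a).card

lemma optimism_next_le (s : State N K) (A : Fin N → Fin K) (i : Fin N) :
    optimism (s.next η A) i ≤ optimism s i :=
  Finset.sum_le_sum fun _ _ => Finset.card_le_card Finset.sdiff_subset

lemma optimism_next_lt {s : State N K} {A : Fin N → Fin K} {i k : Fin N} (hki : k ≠ i)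
    (hk : resolve η A k = some (A i)) (hmem : k ∈ s.lower i (A i)) :
    optimism (s.next η A) i < optimism s i := by
  refine Finset.sum_lt_sum (fun _ _ => Finset.card_le_card Finset.sdiff_subset)
    ⟨A i, Finset.mem_univ _, Finset.card_lt_card ?_⟩
  refine Finset.ssubset_iff_of_subset Finset.sdiff_subset |>.2 ⟨k, hmem, fun h => ?_⟩
  exact (Finset.mem_sdiff.1 h).2 (by simp [lostTo, hki, hk])

/-- A player that explores while everybody else is delayed loses to the holder and refutes one of
its beliefs, so a large number of explorations is unlikely. -/
lemma isDelaySupermartingale_exploring (hNK : N ≤ K) (hη : ∀ a, Function.Injective (η a))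
    (hτ : ∀ t i (S : Finset (Fin K)), S.Nonempty → τ t i S ∈ S) {ε : ℝ} (hε0 : 0 ≤ ε)
    (hε : ∀ S, ε ≤ (rowLaw N lam).real {S}) (i : Fin N) :
    IsDelaySupermartingale lam fun t ω =>
      (optimism (run η τ ω t) i : ℝ) + ε * count (Exploring η τ i) t ω where
  measurable t := by
    refine Measurable.add ?_ (Measurable.const_mul ?_ _)
    · exact (measurable_of_countable fun s : State N K => (optimism s i : ℝ)).comp
        (measurable_run t)
    · exact (measurable_of_countable fun n : ℕ => (n : ℝ)).comp
        (measurable_count (measurableSet_exploring i) t)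
  nonneg t ω := by positivity
  drift t ht ω := by
    have hcount : ∀ S, count (Exploring η τ i) (t + 1) (setRow ω (t + 1) S) =
        count (Exploring η τ i) t ω + if Exploring η τ i t ω then 1 else 0 := fun S => by
      rw [count_congr fun u hu => exploring_setRow i ω hu S, count_succ _ ht]
    simp only [hcount]
    have hle : ∀ S, (optimism (run η τ (setRow ω (t + 1) S) (t + 1)) i : ℝ) ≤
        optimism (run η τ ω t) i := fun S => by
      rw [run_succ_setRow ω ht]
      exact_mod_cast optimism_next_le _ _ i
    by_cases h : Exploring η τ i t ω
    · have hlt : (optimism (run η τ (setRow ω (t + 1) (delayOthers i)) (t + 1)) i : ℝ) + 1 ≤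
          optimism (run η τ ω t) i := by
        obtain ⟨k, hki, hk, hk'⟩ := exists_holder_of_notMem_openArms hη h
        have hA := attempt_succ_delayOthers (η := η) (τ := τ) ω ht i
        have hmem := (Finset.mem_filter.1 (Finset.mem_filter.1
          (choice_mem_ucbArgmax hNK hτ ω t i)).1).2 k hk hki
        have hAi : (run η τ (setRow ω (t + 1) (delayOthers i)) (t + 1)).attempt i =
            choice η τ i t ω := by rw [hA]; simp
        rw [← hA, ← hAi] at hk'
        rw [← hAi] at hmem
        rw [run_succ_setRow ω ht] at hk' hmem ⊢
        exact_mod_cast optimism_next_lt hki hk' hmem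
      refine (sum_rowLaw_mul_le hε (v := (optimism (run η τ ω t) i : ℝ) +
        ε * (count (Exploring η τ i) t ω + 1)) (u := (optimism (run η τ ω t) i : ℝ) +
        ε * (count (Exploring η τ i) t ω + 1) - 1) (S₀ := delayOthers i) (fun S => ?_)
        (by linarith) ?_).trans ?_
      · simp only [h, if_true, Nat.cast_add, Nat.cast_one]
        linarith [hle S]
      · simp only [h, if_true, Nat.cast_add, Nat.cast_one]
        linarith
      · exact le_of_eq (by ring)
    · simp only [h, if_false, add_zero]
      refine (sum_rowLaw_mul_le hε (v := (optimism (run η τ ω t) i : ℝ) +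
        ε * count (Exploring η τ i) t ω) (S₀ := delayOthers i) (fun S => ?_) le_rfl ?_).trans ?_
      · linarith [hle S]
      · linarith [hle (delayOthers i)]
      · exact le_of_eq (by ring)

lemma eventually_not_of_count_le {B : ℕ → Sample N K → Prop} {ω : Sample N K} {C : ℕ}
    (h : ∀ T, count B T ω ≤ C) : ∀ᶠ t in atTop, ¬ B t ω := by
  by_contra hcon
  have hinf : {t | 1 ≤ t ∧ B t ω}.Infinite := by
    refine Nat.frequently_atTop_iff_infinite.1 ?_
    have hf : ∃ᶠ t in atTop, B t ω := fun h => hcon h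
    exact (hf.and_eventually (eventually_ge_atTop 1)).mono fun t ht => ⟨ht.2, ht.1⟩
  obtain ⟨s, hs, hcard⟩ := hinf.exists_subset_card_eq (C + 1)
  have hsub : s ⊆ (Finset.Ico 1 (s.sup id + 1)).filter fun t => B t ω := fun t ht => by
    have h1 := hs ht
    have h2 : t ≤ s.sup id := Finset.le_sup (f := id) ht
    exact Finset.mem_filter.2 ⟨Finset.mem_Ico.2 ⟨h1.1, by omega⟩, h1.2⟩
  have h3 := Finset.card_le_card hsub
  have h4 : ((Finset.Ico 1 (s.sup id + 1)).filter fun t => B t ω).card ≤ C := h (s.sup id + 1)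
  omega

lemma optimism_le (s : State N K) (i : Fin N) : optimism s i ≤ K * N := by
  calc optimism s i ≤ ∑ _a : Fin K, N :=
        Finset.sum_le_sum fun a _ => (Finset.card_le_univ _).trans (by simp)
    _ = K * N := by simp

lemma ae_exploring_bounded (hNK : N ≤ K) (hη : ∀ a, Function.Injective (η a))
    (hτ : ∀ t i (S : Finset (Fin K)), S.Nonempty → τ t i S ∈ S) {ε : ℝ} (hε0 : 0 < ε)
    (hε : ∀ S, ε ≤ (rowLaw N lam).real {S}) :
    ∀ᵐ ω ∂(law lam μ), ∀ i, ∃ B, ∀ T, count (Exploring η τ i) T ω ≤ B := by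
  refine ae_all_iff.2 fun i => ?_
  refine (isDelaySupermartingale_exploring hNK hη hτ hε0.le hε i).ae_bounded hNK (b := K * N)
    (fun ω => ?_) (fun ω => count_mono _ ω) hε0 fun t ω => ?_
  · simp only [count_one, Nat.cast_zero, mul_zero, add_zero]
    exact_mod_cast optimism_le _ i
  · simp

/-! ### Confidence bounds -/

/-- The strong law of large numbers along a sequence of coordinates with the same distribution. -/
lemma ae_tendsto_average_infinitePi {ι : Type*} (m : ι → ℝ) {e : ℕ → ι}
    (he : Function.Injective e) {c : ℝ} (hc : ∀ j, m (e j) = c) :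
    ∀ᵐ r ∂(Measure.infinitePi fun x => gaussianReal (m x) 1),
      Tendsto (fun n : ℕ => (∑ j ∈ Finset.range n, r (e j)) / (n : ℝ)) atTop (𝓝 c) := by
  set P := Measure.infinitePi fun x => gaussianReal (m x) 1 with hP
  have hm : ∀ j : ℕ, Measurable fun r : ι → ℝ => r (e j) := fun j => measurable_pi_apply _
  have hmap : ∀ j : ℕ, P.map (fun r => r (e j)) = gaussianReal c 1 := fun j => by
    rw [← hc j]
    exact Measure.infinitePi_map_eval (fun x => gaussianReal (m x) 1) (e j)
  have hint : Integrable (fun r : ι → ℝ => r (e 0)) P := by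
    have h : Integrable id (P.map fun r => r (e 0)) := by
      rw [hmap]
      exact (memLp_id_gaussianReal 1).integrable (by simp)
    exact (integrable_map_measure (by fun_prop) (hm 0).aemeasurable).1 h
  have hmean : ∫ r, r (e 0) ∂P = c := by
    rw [← integral_map (f := fun x : ℝ => x) (hm 0).aemeasurable (by fun_prop), hmap]
    exact integral_id_gaussianReal
  have hind : iIndepFun (fun (x : ι) (r : ι → ℝ) => r x) P :=
    iIndepFun_infinitePi (X := fun _ x => x) fun _ => measurable_id
  have h := strong_law_ae_real (fun (j : ℕ) (r : ι → ℝ) => r (e j)) hint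
    (fun j k hjk => hind.indepFun (he.ne hjk)) fun j =>
      ⟨(hm j).aemeasurable, (hm 0).aemeasurable, by rw [hmap, hmap]⟩
  rwa [hmean] at h

lemma ae_tendsto_average (hNK : N ≤ K) : ∀ᵐ ω ∂(law lam μ), ∀ (i : Fin N) (a : Fin K),
    Tendsto (fun n : ℕ => (∑ j ∈ Finset.range n, ω.2.2 (i, a, j)) / (n : ℝ)) atTop
      (𝓝 (μ i a)) := by
  have := fun i : Fin N => isProbabilityMeasure_uniformOn hNK i
  refine ae_all_iff.2 fun i => ae_all_iff.2 fun a => ?_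
  have h := ae_tendsto_average_infinitePi (fun x : Fin N × Fin K × ℕ => μ x.1 x.2.1)
    (e := fun j => (i, a, j)) (fun j k h => by simpa using h) (c := μ i a) (fun _ => rfl)
  exact (Measure.quasiMeasurePreserving_snd.comp Measure.quasiMeasurePreserving_snd).ae h

/-- Late upper confidence bounds rank two arms in the right order, unless the worse arm has been
pulled at most logarithmically often: the means of both arms are accurate after a bounded number
of pulls, and the confidence radius at smaller numbers of pulls grows with the round. -/
lemma eventually_pulls_le {ω : Sample N K} {i : Fin N} {a b : Fin K}
    (ha : Tendsto (fun n : ℕ => (∑ j ∈ Finset.range n, ω.2.2 (i, a, j)) / n) atTop (𝓝 (μ i a)))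
    (hb : Tendsto (fun n : ℕ => (∑ j ∈ Finset.range n, ω.2.2 (i, b, j)) / n) atTop (𝓝 (μ i b)))
    (hab : μ i a < μ i b) :
    ∀ᶠ t : ℕ in atTop, ∀ n m : ℕ, ucb ω t i b m ≤ ucb ω t i a n →
      (n : ℝ) ≤ 24 / (μ i b - μ i a) ^ 2 * Real.log t := by
  have hΔ : 0 < μ i b - μ i a := sub_pos.2 hab
  set δ := (μ i b - μ i a) / 4 with hδ
  have hδ0 : 0 < δ := by positivity
  obtain ⟨n₀, hn₀⟩ := eventually_atTop.1 ((ha.eventually_lt_const (lt_add_of_pos_right _ hδ0)).and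
    (hb.eventually_const_lt (sub_lt_self _ hδ0)))
  have hlog : Tendsto (fun t : ℕ => Real.log t) atTop atTop :=
    Real.tendsto_log_atTop.comp tendsto_natCast_atTop_atTop
  have hC : 0 < 24 / (μ i b - μ i a) ^ 2 := by positivity
  have h1 : ∀ᶠ t : ℕ in atTop, ∀ m ∈ Finset.range n₀, m ≠ 0 →
      μ i b - δ < (∑ j ∈ Finset.range m, ω.2.2 (i, b, j)) / m
        + Real.sqrt (3 * Real.log t / (2 * m)) := by
    refine (Finset.range n₀).eventually_all.2 fun m _ => ?_
    by_cases hm : m = 0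
    · simp [hm]
    have hm0 : (0 : ℝ) < m := by positivity
    have ht : Tendsto (fun t : ℕ => (∑ j ∈ Finset.range m, ω.2.2 (i, b, j)) / m
        + Real.sqrt (3 * Real.log t / (2 * m))) atTop atTop :=
      tendsto_atTop_add_const_left _ _ (Real.tendsto_sqrt_atTop.comp
        ((hlog.const_mul_atTop (by norm_num : (0 : ℝ) < 3)).atTop_div_const (by positivity)))
    exact (ht.eventually_gt_atTop _).mono fun t h _ => h
  filter_upwards [h1, (hlog.const_mul_atTop hC).eventually_ge_atTop (n₀ : ℝ),
    hlog.eventually_gt_atTop 0] with t ht1 ht2 ht3 n m hle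
  by_contra! hn
  have hnn : n₀ ≤ n := by exact_mod_cast ht2.trans hn.le
  have hn0 : (0 : ℝ) < n := (mul_pos hC ht3).trans hn
  have hn0' : n ≠ 0 := by
    rintro rfl
    simp at hn0
  have hrad : Real.sqrt (3 * Real.log t / (2 * n)) ≤ δ := by
    refine (Real.sqrt_le_left hδ0.le).2 ?_
    rw [div_mul_eq_mul_div, div_lt_iff₀ (by positivity)] at hn
    rw [div_le_iff₀ (by positivity), hδ]
    nlinarith
  have hA := (hn₀ n hnn).1
  rcases eq_or_ne m 0 with rfl | hm
  · simp only [ucb, if_true, hn0', if_false, top_le_iff] at hle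
    exact EReal.coe_ne_top _ hle
  · simp only [ucb, hm, hn0', if_false, EReal.coe_le_coe_iff] at hle
    have hB : μ i b - δ < (∑ j ∈ Finset.range m, ω.2.2 (i, b, j)) / m
        + Real.sqrt (3 * Real.log t / (2 * m)) := by
      by_cases hmn : m < n₀
      · exact ht1 m (Finset.mem_range.2 hmn) hm
      · linarith [(hn₀ m (not_lt.1 hmn)).2, Real.sqrt_nonneg (3 * Real.log t / (2 * m))]
    linarith

lemma pulls_mono (ω : Sample N K) (i : Fin N) (a : Fin K) :
    Monotone fun t => (run η τ ω t).pulls i a :=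
  monotone_nat_of_le_succ fun _ => Nat.le_add_right _ _

/-- The misled pulls of an arm up to round `T` see different numbers of earlier pulls, all of them
at most logarithmic in `T`. -/
lemma exists_misledPull_le (hNK : N ≤ K) (hμ : ∀ i, Function.Injective (μ i))
    (hτ : ∀ t i (S : Finset (Fin K)), S.Nonempty → τ t i S ∈ S) (i : Fin N) :
    ∃ C : ℝ, ∀ᵐ ω ∂(law lam μ), ∀ᶠ T : ℕ in atTop,
      (count (MisledPull μ η τ i) T ω : ℝ) ≤ C * Real.log T := by
  set D : ℝ := ∑ p : Fin K × Fin K, 24 / (μ i p.2 - μ i p.1) ^ 2 with hD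
  have hD0 : 0 ≤ D := Finset.sum_nonneg fun p _ => by positivity
  refine ⟨K * D + 1, ?_⟩
  filter_upwards [ae_tendsto_average (lam := lam) (μ := μ) hNK] with ω hω
  have hev : ∀ᶠ t : ℕ in atTop, ∀ a b, μ i a < μ i b → ∀ n m : ℕ,
      ucb ω t i b m ≤ ucb ω t i a n → (n : ℝ) ≤ 24 / (μ i b - μ i a) ^ 2 * Real.log t := by
    refine eventually_all.2 fun a => eventually_all.2 fun b => ?_
    by_cases hab : μ i a < μ i b
    · exact (eventually_pulls_le (hω i a) (hω i b) hab).mono fun t h _ => h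
    · exact Eventually.of_forall fun t h => absurd h hab
  obtain ⟨t₀, ht₀⟩ := eventually_atTop.1 hev
  have hlog : Tendsto (fun t : ℕ => Real.log t) atTop atTop :=
    Real.tendsto_log_atTop.comp tendsto_natCast_atTop_atTop
  filter_upwards [hlog.eventually_ge_atTop ((t₀ : ℝ) + K)] with T hT
  have hlogT : 0 ≤ Real.log T := le_trans (by positivity) hT
  set R := ⌊D * Real.log T⌋₊ with hR
  let late := (Finset.Ico t₀ T).filter fun t => MisledPull μ η τ i t ω
  have hlate : late.card ≤ K * (R + 1) := by
    have : late.card ≤ (Finset.univ ×ˢ Finset.range (R + 1) : Finset (Fin K × ℕ)).card := by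
      refine Finset.card_le_card_of_injOn (fun t => (choice η τ i t ω,
        (run η τ ω t).pulls i (choice η τ i t ω))) (fun t ht => ?_) fun t ht u hu htu => ?_
      · obtain ⟨htT, ⟨hopen, hne⟩, -⟩ := Finset.mem_filter.1 ht
        obtain ⟨ht1, ht2⟩ := Finset.mem_Ico.1 htT
        obtain ⟨hb, hbmax⟩ := bestResponse_spec (μ := μ) (η := η)
          (A := (run η τ ω t).attempt) hNK i
        have hlt : μ i (choice η τ i t ω) <
            μ i (bestResponse μ η (run η τ ω t).attempt i) :=
          lt_of_le_of_ne (hbmax _ hopen) fun e => hne (hμ i e)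
        have hn := ht₀ (t + 1) (by omega) _ _ hlt _ _
          ((Finset.mem_filter.1 (choice_mem_ucbArgmax hNK hτ ω t i)).2 _
            (openArms_subset_ocaPlausible ω t i hb))
        have hterm : 24 / (μ i (bestResponse μ η (run η τ ω t).attempt i) -
            μ i (choice η τ i t ω)) ^ 2 ≤ D :=
          Finset.single_le_sum (f := fun p : Fin K × Fin K => 24 / (μ i p.2 - μ i p.1) ^ 2)
            (fun p _ => by positivity)
            (Finset.mem_univ (choice η τ i t ω, bestResponse μ η (run η τ ω t).attempt i))
        have hmon : Real.log ((t + 1 : ℕ) : ℝ) ≤ Real.log T :=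
          Real.log_le_log (by positivity) (by exact_mod_cast ht2)
        have hfl : (run η τ ω t).pulls i (choice η τ i t ω) ≤ R := by
          refine Nat.le_floor (hn.trans ?_)
          exact mul_le_mul hterm hmon (Real.log_natCast_nonneg _) hD0
        simp only [Finset.coe_product, Set.mem_prod, Finset.coe_univ, Set.mem_univ, true_and,
          Finset.coe_range, Set.mem_Iio]
        omega
      · simp only [Prod.mk.injEq] at htu
        -- each of the pulls increases the number of pulls
        have key : ∀ t ∈ late, ∀ u, t < u → choice η τ i t ω = choice η τ i u ω →
            (run η τ ω t).pulls i (choice η τ i t ω) <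
              (run η τ ω u).pulls i (choice η τ i u ω) := by
          intro t ht u hlt hc
          have hpull := (Finset.mem_filter.1 ht).2.2
          have h1 : (run η τ ω (t + 1)).pulls i (choice η τ i t ω) =
              (run η τ ω t).pulls i (choice η τ i t ω) + 1 := by
            have : (run η τ ω (t + 1)).pulls i (choice η τ i t ω) =
                (run η τ ω t).pulls i (choice η τ i t ω) +
                if resolve η (run η τ ω (t + 1)).attempt i = some (choice η τ i t ω)
                then 1 else 0 := rfl
            rw [this, if_pos hpull]
          have h2 := pulls_mono (η := η) (τ := τ) ω i (choice η τ i t ω) (Nat.succ_le_of_lt hlt)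
          simp only [Nat.succ_eq_add_one] at h2
          rw [← hc]
          omega
        rcases lt_trichotomy t u with h | h | h
        · exact absurd htu.2 (key t ht u h htu.1).ne
        · exact h
        · exact absurd htu.2.symm (key u hu t h htu.1.symm).ne
    simpa using this
  have hsplit : count (MisledPull μ η τ i) T ω ≤ t₀ + late.card := by
    have hsub : ((Finset.Ico 1 T).filter fun t => MisledPull μ η τ i t ω) ⊆
        Finset.range t₀ ∪ late := fun t ht => by
      obtain ⟨h1, h2⟩ := Finset.mem_filter.1 ht
      have h1' := Finset.mem_Ico.1 h1
      by_cases h : t < t₀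
      · exact Finset.mem_union_left _ (Finset.mem_range.2 h)
      · exact Finset.mem_union_right _ (Finset.mem_filter.2
          ⟨Finset.mem_Ico.2 ⟨not_lt.1 h, h1'.2⟩, h2⟩)
    exact (Finset.card_le_card hsub).trans ((Finset.card_union_le _ _).trans (by simp))
  have hRle : (R : ℝ) ≤ D * Real.log T := Nat.floor_le (mul_nonneg hD0 hlogT)
  have hfin : (count (MisledPull μ η τ i) T ω : ℝ) ≤ t₀ + K * (R + 1) := by
    exact_mod_cast hsplit.trans (Nat.add_le_add_left hlate _)
  have hKR : (K : ℝ) * R ≤ K * (D * Real.log T) := mul_le_mul_of_nonneg_left hRle (by positivity)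
  linarith

/-- A misled player obtains the arm that it selects when everybody else is delayed, so many
misled selections with few misled pulls are unlikely. -/
lemma isDelaySupermartingale_misled (hη : ∀ a, Function.Injective (η a)) {ε : ℝ} (hε1 : ε ≤ 1)
    (hε : ∀ S, ε ≤ (rowLaw N lam).real {S}) (i : Fin N) :
    IsDelaySupermartingale lam fun t ω =>
      (1 - ε / 2)⁻¹ ^ count (Misled μ η τ i) t ω *
        (1 / 2 : ℝ) ^ count (MisledPull μ η τ i) t ω where
  measurable t := by
    refine Measurable.mul ?_ ?_
    · exact (measurable_of_countable fun n : ℕ => (1 - ε / 2)⁻¹ ^ n).comp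
        (measurable_count (measurableSet_misled i) t)
    · exact (measurable_of_countable fun n : ℕ => (1 / 2 : ℝ) ^ n).comp
        (measurable_count (measurableSet_misledPull i) t)
  nonneg t ω := by
    have : 0 < 1 - ε / 2 := by linarith
    positivity
  drift t ht ω := by
    have hq : 0 < 1 - ε / 2 := by linarith
    have hM : ∀ S, count (Misled μ η τ i) (t + 1) (setRow ω (t + 1) S) =
        count (Misled μ η τ i) t ω + if Misled μ η τ i t ω then 1 else 0 := fun S => by
      rw [count_congr fun u hu => misled_setRow i ω hu S, count_succ _ ht]
    have hG : ∀ S, count (MisledPull μ η τ i) (t + 1) (setRow ω (t + 1) S) =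
        count (MisledPull μ η τ i) t ω +
          if MisledPull μ η τ i t (setRow ω (t + 1) S) then 1 else 0 := fun S => by
      rw [count_succ _ ht, count_congr fun u hu =>
        misledPull_setRow i ω (by omega : u + 1 < t + 1) S]
    simp only [hM, hG]
    set w := (1 - ε / 2)⁻¹ ^ count (Misled μ η τ i) t ω with hw
    set g := (1 / 2 : ℝ) ^ count (MisledPull μ η τ i) t ω with hg
    have hw0 : 0 < w := by positivity
    have hg0 : 0 < g := by positivity
    by_cases h : Misled μ η τ i t ω
    · have hwin : MisledPull μ η τ i t (setRow ω (t + 1) (delayOthers i)) := by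
        refine ⟨(misled_setRow i ω (Nat.lt_succ_self t) _).2 h, ?_⟩
        rw [attempt_succ_delayOthers ω ht, choice_setRow i ω (Nat.lt_succ_self t)]
        exact resolve_update_self hη h.1
      have hv0 : 0 < (1 - ε / 2)⁻¹ * (w * g) := by positivity
      refine (sum_rowLaw_mul_le hε (v := (1 - ε / 2)⁻¹ * (w * g))
        (u := (1 - ε / 2)⁻¹ * (w * g) / 2) (S₀ := delayOthers i) (fun S => ?_)
        (by linarith) ?_).trans ?_
      · rw [if_pos h, pow_succ, pow_add, ← hw, ← hg]
        have : (1 / 2 : ℝ) ^ (if MisledPull μ η τ i t (setRow ω (t + 1) S) then 1 else 0) ≤ 1 :=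
          pow_le_one₀ (by norm_num) (by norm_num)
        calc _ = ((1 - ε / 2)⁻¹ * (w * g)) *
              (1 / 2 : ℝ) ^ (if MisledPull μ η τ i t (setRow ω (t + 1) S) then 1 else 0) := by ring
          _ ≤ _ := mul_le_of_le_one_right hv0.le this
      · rw [if_pos h, if_pos hwin, pow_succ, pow_succ, ← hw, ← hg]
        exact le_of_eq (by ring)
      · refine le_of_eq ?_
        linear_combination (w * g) * inv_mul_cancel₀ hq.ne'
    · have hlose : ∀ S, ¬ MisledPull μ η τ i t (setRow ω (t + 1) S) := fun S hS =>
        h ((misled_setRow i ω (Nat.lt_succ_self t) S).1 hS.1)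
      simp only [h, hlose, if_false, add_zero, ← hw, ← hg, ← Finset.sum_mul, sum_rowLaw, one_mul,
        le_refl]

lemma exists_misled_le (hNK : N ≤ K) (hμ : ∀ i, Function.Injective (μ i))
    (hη : ∀ a, Function.Injective (η a))
    (hτ : ∀ t i (S : Finset (Fin K)), S.Nonempty → τ t i S ∈ S) {ε : ℝ} (hε0 : 0 < ε)
    (hε1 : ε ≤ 1) (hε : ∀ S, ε ≤ (rowLaw N lam).real {S}) (i : Fin N) :
    ∃ C : ℝ, ∀ᵐ ω ∂(law lam μ), ∀ᶠ T : ℕ in atTop,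
      (count (Misled μ η τ i) T ω : ℝ) ≤ C * Real.log T := by
  obtain ⟨C, hC⟩ := exists_misledPull_le (lam := lam) (η := η) hNK hμ hτ i
  have hq : 0 < 1 - ε / 2 := by linarith
  have hl : 0 < Real.log (1 - ε / 2)⁻¹ :=
    Real.log_pos ((one_lt_inv₀ hq).2 (by linarith))
  refine ⟨(C * Real.log 2 + 2) / Real.log (1 - ε / 2)⁻¹, ?_⟩
  filter_upwards [hC, (isDelaySupermartingale_misled (μ := μ) (τ := τ) hη hε1 hε
    i).ae_eventually_le_sq (μ := μ) hNK (b := 1) fun ω => by simp [count_one]] with ω h1 h2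
  filter_upwards [h1, h2, eventually_ge_atTop 1] with T hT1 hT2 hT
  have hlog := Real.log_le_log (by positivity) hT2
  have hT0 : (0 : ℝ) < T := by exact_mod_cast hT
  rw [Real.log_mul (by positivity) (by positivity), Real.log_pow, Real.log_pow, Real.log_pow,
    one_div, Real.log_inv 2] at hlog
  push_cast at hlog
  rw [div_mul_eq_mul_div, le_div_iff₀ hl]
  have h3 := mul_le_mul_of_nonneg_right hT1 (Real.log_nonneg (one_le_two (α := ℝ)))
  nlinarith

lemma count_erring_le (ω : Sample N K) (T : ℕ) : count (Erring μ η τ) T ω ≤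
    ∑ i, (count (Exploring η τ i) T ω + count (Misled μ η τ i) T ω) := by
  have hsub : ((Finset.Ico 1 T).filter fun t => Erring μ η τ t ω) ⊆
      Finset.univ.biUnion fun i => ((Finset.Ico 1 T).filter fun t => Exploring η τ i t ω) ∪
        ((Finset.Ico 1 T).filter fun t => Misled μ η τ i t ω) := fun t ht => by
    obtain ⟨hT, i, hi⟩ := Finset.mem_filter.1 ht
    refine Finset.mem_biUnion.2 ⟨i, Finset.mem_univ i, ?_⟩
    by_cases h : Exploring η τ i t ω
    · exact Finset.mem_union_left _ (Finset.mem_filter.2 ⟨hT, h⟩)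
    · exact Finset.mem_union_right _ (Finset.mem_filter.2 ⟨hT, not_not.1 h, hi⟩)
  exact (Finset.card_le_card hsub).trans (Finset.card_biUnion_le.trans
    (Finset.sum_le_sum fun i _ => Finset.card_union_le _ _))

lemma exists_erring_le (hNK : N ≤ K) (hμ : ∀ i, Function.Injective (μ i))
    (hη : ∀ a, Function.Injective (η a))
    (hτ : ∀ t i (S : Finset (Fin K)), S.Nonempty → τ t i S ∈ S) {ε : ℝ} (hε0 : 0 < ε)
    (hε1 : ε ≤ 1) (hε : ∀ S, ε ≤ (rowLaw N lam).real {S}) :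
    ∃ C : ℝ, ∀ᵐ ω ∂(law lam μ), ∀ᶠ T : ℕ in atTop,
      (count (Erring μ η τ) T ω : ℝ) ≤ C * Real.log T := by
  choose C hC using exists_misled_le (lam := lam) hNK hμ hη hτ hε0 hε1 hε
  refine ⟨1 + ∑ i, C i, ?_⟩
  filter_upwards [ae_all_iff.2 hC,
    ae_exploring_bounded (μ := μ) hNK hη hτ hε0 hε] with ω h1 h2
  choose B hB using h2
  have hlog : Tendsto (fun t : ℕ => Real.log t) atTop atTop :=
    Real.tendsto_log_atTop.comp tendsto_natCast_atTop_atTop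
  filter_upwards [eventually_all.2 h1,
    hlog.eventually_ge_atTop (∑ i, (B i : ℝ))] with T hT1 hT2
  have h3 : (count (Erring μ η τ) T ω : ℝ) ≤
      ∑ i, ((count (Exploring η τ i) T ω : ℝ) + count (Misled μ η τ i) T ω) := by
    exact_mod_cast count_erring_le ω T
  have h4 : ∑ i, ((count (Exploring η τ i) T ω : ℝ) + count (Misled μ η τ i) T ω) ≤
      ∑ i, ((B i : ℝ) + C i * Real.log T) :=
    Finset.sum_le_sum fun i _ => add_le_add (by exact_mod_cast hB i T) (hT1 i)
  rw [Finset.sum_add_distrib (f := fun i => (B i : ℝ)), ← Finset.sum_mul] at h4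
  linarith

/-! ### Unstable rounds -/

/-- Without errors the potential decreases in expectation while the matching is unstable, and
stable matchings persist; so many unstable rounds with few errors are unlikely. -/
lemma isDelaySupermartingale_unsettled {ε ρ : ℝ}
    (hε : ∀ S, ε ≤ (rowLaw N lam).real {S}) {ψ : (Fin N → Fin K) → ℝ} (hρ0 : 0 < ρ)
    (hρ1 : ρ < 1) (hψ : ∀ A, 1 / 2 ≤ ψ A ∧ ψ A ≤ 1)
    (hdrift : ∀ A, ¬ (∀ i, bestResponse μ η A i = A i) →
      ∃ i, 1 - ε * (1 - ψ (Function.update A i (bestResponse μ η A i))) ≤ ρ * ψ A) :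
    IsDelaySupermartingale lam fun t ω =>
      ρ⁻¹ ^ count (Unsettled μ η τ) t ω * (ρ / 2) ^ count (Erring μ η τ) t ω *
        ψ (run η τ ω t).attempt where
  measurable t := by
    refine Measurable.mul (Measurable.mul ?_ ?_) ?_
    · exact (measurable_of_countable fun n : ℕ => ρ⁻¹ ^ n).comp
        (measurable_count measurableSet_unsettled t)
    · exact (measurable_of_countable fun n : ℕ => (ρ / 2) ^ n).comp
        (measurable_count measurableSet_erring t)
    · exact (measurable_of_countable fun s : State N K => ψ s.attempt).comp (measurable_run t)
  nonneg t ω := mul_nonneg (by positivity) (le_trans (by norm_num) (hψ _).1)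
  drift t ht ω := by
    have hU : ∀ S, count (Unsettled μ η τ) (t + 1) (setRow ω (t + 1) S) =
        count (Unsettled μ η τ) t ω + if Unsettled μ η τ t ω then 1 else 0 := fun S => by
      rw [count_congr fun u hu => unsettled_setRow ω hu S, count_succ _ ht]
    have hE : ∀ S, count (Erring μ η τ) (t + 1) (setRow ω (t + 1) S) =
        count (Erring μ η τ) t ω + if Erring μ η τ t ω then 1 else 0 := fun S => by
      rw [count_congr fun u hu => erring_setRow ω hu S, count_succ _ ht]
    simp only [hU, hE, pow_add]
    set w := ρ⁻¹ ^ count (Unsettled μ η τ) t ω * (ρ / 2) ^ count (Erring μ η τ) t ω with hw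
    have hw0 : 0 < w := by positivity
    have hρi : 1 ≤ ρ⁻¹ := (one_le_inv₀ hρ0).2 hρ1.le
    have hψ0 : ∀ A, 0 ≤ ψ A := fun A => le_trans (by norm_num) (hψ A).1
    by_cases he : Erring μ η τ t ω
    · -- the penalty `ρ / 2` for an error pays for the unstable round and for the potential
      have hle : ∀ S, ρ⁻¹ ^ count (Unsettled μ η τ) t ω *
          ρ⁻¹ ^ (if Unsettled μ η τ t ω then 1 else 0) *
          ((ρ / 2) ^ count (Erring μ η τ) t ω * (ρ / 2) ^ (if Erring μ η τ t ω then 1 else 0)) *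
          ψ (run η τ (setRow ω (t + 1) S) (t + 1)).attempt ≤ w * (1 / 2) := fun S => by
        have h1 : ρ⁻¹ ^ (if Unsettled μ η τ t ω then 1 else 0) ≤ ρ⁻¹ := by
          split_ifs
          · simp
          · simpa using hρi
        rw [if_pos he, pow_one]
        calc _ = w * (ρ / 2) * (ρ⁻¹ ^ (if Unsettled μ η τ t ω then 1 else 0) *
              ψ (run η τ (setRow ω (t + 1) S) (t + 1)).attempt) := by rw [hw]; ring
          _ ≤ w * (ρ / 2) * (ρ⁻¹ * 1) := by
              refine mul_le_mul_of_nonneg_left ?_ (by positivity)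
              exact mul_le_mul h1 (hψ _).2 (hψ0 _) (by positivity)
          _ = w * (1 / 2) := by field_simp
      obtain ⟨i, -⟩ := he
      refine (sum_rowLaw_mul_le hε hle le_rfl (hle (delayOthers i))).trans ?_
      rw [sub_self, mul_zero, sub_zero]
      exact mul_le_mul_of_nonneg_left (hψ _).1 hw0.le
    · have hbest : ∀ i, choice η τ i t ω = bestResponse μ η (run η τ ω t).attempt i := by
        simpa [Erring] using he
      simp only [he, if_false, pow_zero, mul_one]
      by_cases hu : Unsettled μ η τ t ω
      · obtain ⟨i, hi⟩ := hdrift _ hu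
        have hval : ∀ S, ρ⁻¹ ^ count (Unsettled μ η τ) t ω *
            ρ⁻¹ ^ (if Unsettled μ η τ t ω then 1 else 0) * (ρ / 2) ^ count (Erring μ η τ) t ω *
            ψ (run η τ (setRow ω (t + 1) S) (t + 1)).attempt =
            w * ρ⁻¹ * ψ (run η τ (setRow ω (t + 1) S) (t + 1)).attempt := fun S => by
          rw [if_pos hu, hw]; ring
        simp only [hval]
        have hv0 : 0 < w * ρ⁻¹ := by positivity
        refine (sum_rowLaw_mul_le hε (v := w * ρ⁻¹) (u := w * ρ⁻¹ *
          ψ (Function.update (run η τ ω t).attempt i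
            (bestResponse μ η (run η τ ω t).attempt i))) (S₀ := delayOthers i)
          (fun S => mul_le_of_le_one_right hv0.le (hψ _).2)
          (mul_le_of_le_one_right hv0.le (hψ _).2) ?_).trans ?_
        · rw [attempt_succ_delayOthers ω ht, hbest]
        · calc _ = w * ρ⁻¹ * (1 - ε * (1 - ψ (Function.update (run η τ ω t).attempt i
                (bestResponse μ η (run η τ ω t).attempt i)))) := by ring
            _ ≤ w * ρ⁻¹ * (ρ * ψ (run η τ ω t).attempt) :=
                mul_le_mul_of_nonneg_left hi hv0.le
            _ = _ := by field_simp
      · have hstay : ∀ S, (run η τ (setRow ω (t + 1) S) (t + 1)).attempt =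
            (run η τ ω t).attempt := fun S => by
          rw [attempt_succ_setRow ω ht]
          funext i
          rw [hbest i, (not_not.1 hu) i, ite_self]
        simp only [hu, hstay, if_false, pow_zero, mul_one, ← hw, ← Finset.sum_mul, sum_rowLaw,
          one_mul, le_refl]

lemma exists_unsettled_le (hNK : N ≤ K) (hμ : ∀ i, Function.Injective (μ i))
    (hη : ∀ a, Function.Injective (η a))
    (hτ : ∀ t i (S : Finset (Fin K)), S.Nonempty → τ t i S ∈ S) {ε : ℝ} (hε0 : 0 < ε)
    (hε1 : ε ≤ 1) (hε : ∀ S, ε ≤ (rowLaw N lam).real {S}) :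
    ∃ C : ℝ, ∀ᵐ ω ∂(law lam μ), ∀ᶠ T : ℕ in atTop,
      (count (Unsettled μ η τ) T ω : ℝ) ≤ C * Real.log T := by
  obtain ⟨C, hC⟩ := exists_erring_le (lam := lam) hNK hμ hη hτ hε0 hε1 hε
  obtain ⟨ψ, ρ, hρ0, hρ1, hψ, hdrift⟩ := exists_potential hNK hμ hη hε0 hε1
  have hl : 0 < Real.log ρ⁻¹ := Real.log_pos ((one_lt_inv₀ hρ0).2 hρ1)
  have hl2 : 0 ≤ Real.log (2 / ρ) := Real.log_nonneg ((one_le_div hρ0).2 (by linarith))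
  refine ⟨(C * Real.log (2 / ρ) + 3) / Real.log ρ⁻¹, ?_⟩
  filter_upwards [hC, (isDelaySupermartingale_unsettled (τ := τ) hε hρ0 hρ1 hψ
    hdrift).ae_eventually_le_sq (μ := μ) hNK (b := 1) fun ω => by
      simpa [count_one] using (hψ _).2] with ω h1 h2
  filter_upwards [h1, h2, eventually_ge_atTop 2] with T hT1 hT2 hT
  have hT0 : (2 : ℝ) ≤ T := by exact_mod_cast hT
  have hT2' : ρ⁻¹ ^ count (Unsettled μ η τ) T ω * (ρ / 2) ^ count (Erring μ η τ) T ω * (1 / 2) ≤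
      (T : ℝ) ^ 2 :=
    (mul_le_mul_of_nonneg_left (hψ _).1 (by positivity)).trans hT2
  have hlog := Real.log_le_log (by positivity) hT2'
  have hinv : ρ / 2 = (2 / ρ)⁻¹ := by rw [inv_div]
  rw [Real.log_mul (by positivity) (by norm_num), Real.log_mul (by positivity) (by positivity),
    Real.log_pow, Real.log_pow, Real.log_pow, hinv, Real.log_inv (2 / ρ), one_div,
    Real.log_inv 2] at hlog
  push_cast at hlog
  have hlog2 : Real.log 2 ≤ Real.log T := Real.log_le_log (by norm_num) hT0
  rw [div_mul_eq_mul_div, le_div_iff₀ hl]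
  have h3 := mul_le_mul_of_nonneg_right hT1 hl2
  nlinarith

lemma not_isStable_iff_unsettled (hNK : N ≤ K) (hμ : ∀ i, Function.Injective (μ i))
    (hη : ∀ a, Function.Injective (η a)) (t : ℕ) (ω : Sample N K) :
    ¬ IsStable μ η (matchingAt η τ ω t) ↔ Unsettled μ η τ t ω :=
  not_congr (isStable_resolve_iff hNK hμ hη)

lemma unstableRounds_eq (hNK : N ≤ K) (hμ : ∀ i, Function.Injective (μ i))
    (hη : ∀ a, Function.Injective (η a)) (T : ℕ) (ω : Sample N K) :
    unstableRounds μ η τ ω T = count (Unsettled μ η τ) (T + 1) ω := by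
  unfold unstableRounds count
  congr 1
  ext t
  simp only [Finset.mem_filter, Finset.mem_Icc, Finset.mem_Ico, Nat.lt_succ_iff,
    not_isStable_iff_unsettled hNK hμ hη]

lemma exists_unstableRounds_le (hNK : N ≤ K) (hμ : ∀ i, Function.Injective (μ i))
    (hη : ∀ a, Function.Injective (η a))
    (hτ : ∀ t i (S : Finset (Fin K)), S.Nonempty → τ t i S ∈ S) {ε : ℝ} (hε0 : 0 < ε)
    (hε1 : ε ≤ 1) (hε : ∀ S, ε ≤ (rowLaw N lam).real {S}) :
    ∃ C : ℝ, ∀ᵐ ω ∂(law lam μ), ∀ᶠ T : ℕ in atTop,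
      (unstableRounds μ η τ ω T : ℝ) ≤ C * Real.log T := by
  obtain ⟨C, hC⟩ := exists_unsettled_le (lam := lam) hNK hμ hη hτ hε0 hε1 hε
  refine ⟨C + 1, ?_⟩
  filter_upwards [hC] with ω hω
  filter_upwards [hω, (Real.tendsto_log_atTop.comp
    tendsto_natCast_atTop_atTop).eventually_ge_atTop 1, eventually_ge_atTop 1] with T hT hT1 hT2
  rw [unstableRounds_eq hNK hμ hη, count_succ _ hT2]
  simp only [Function.comp_apply] at hT1
  push_cast
  split_ifs <;> linarith

/-- By dominated convergence. -/
lemma tendsto_unstable_fraction (hNK : N ≤ K) (hμ : ∀ i, Function.Injective (μ i))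
    (hη : ∀ a, Function.Injective (η a)) {C : ℝ}
    (hC : ∀ᵐ ω ∂(law lam μ), ∀ᶠ T : ℕ in atTop,
      (unstableRounds μ η τ ω T : ℝ) ≤ C * Real.log T) :
    Tendsto (fun T : ℕ => (∑ t ∈ Finset.Icc 1 T, (law lam μ).real
        {ω | ¬ IsStable μ η (matchingAt η τ ω t)}) / (T : ℝ)) atTop (𝓝 0) := by
  have := isProbabilityMeasure_law (lam := lam) (μ := μ) hNK
  have hset : ∀ t, MeasurableSet {ω : Sample N K | ¬ IsStable μ η (matchingAt η τ ω t)} :=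
    fun t => by
      simp only [not_isStable_iff_unsettled hNK hμ hη]
      exact measurableSet_unsettled t
  have hmean : ∀ T : ℕ, (∑ t ∈ Finset.Icc 1 T, (law lam μ).real
      {ω | ¬ IsStable μ η (matchingAt η τ ω t)}) / (T : ℝ) =
      ∫ ω, (unstableRounds μ η τ ω T : ℝ) / T ∂(law lam μ) := fun T => by
    rw [integral_div]
    congr 1
    have hsum : ∀ ω, (unstableRounds μ η τ ω T : ℝ) = ∑ t ∈ Finset.Icc 1 T,
        {ω | ¬ IsStable μ η (matchingAt η τ ω t)}.indicator (fun _ => (1 : ℝ)) ω := fun ω => by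
      unfold unstableRounds
      rw [Finset.card_filter]
      push_cast
      exact Finset.sum_congr rfl fun t _ => by simp [Set.indicator_apply]
    simp_rw [hsum]
    rw [integral_finsetSum _ fun t _ => (integrable_const (1 : ℝ)).indicator (hset t)]
    refine Finset.sum_congr rfl fun t _ => ?_
    rw [integral_indicator (hset t), setIntegral_const, smul_eq_mul, mul_one]
  simp_rw [hmean]
  rw [show (0 : ℝ) = ∫ _, (0 : ℝ) ∂(law (N := N) lam μ) by simp]
  refine tendsto_integral_of_dominated_convergence (fun _ => 1) (fun T => ?_)
    (integrable_const 1) (fun T => ae_of_all _ fun ω => ?_) ?_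
  · simp_rw [unstableRounds_eq hNK hμ hη]
    exact ((measurable_of_countable fun n : ℕ => (n : ℝ) / T).comp
      (measurable_count measurableSet_unsettled (T + 1))).aestronglyMeasurable
  · have : unstableRounds μ η τ ω T ≤ T := (Finset.card_filter_le _ _).trans (by simp)
    rw [Real.norm_of_nonneg (by positivity)]
    exact div_le_one_of_le₀ (by exact_mod_cast this) (by positivity)
  · filter_upwards [hC] with ω hω
    have hlim : Tendsto (fun T : ℕ => C * (Real.log T / T)) atTop (𝓝 0) := by
      have h := (Real.isLittleO_log_id_atTop.tendsto_div_nhds_zero.comp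
        (tendsto_natCast_atTop_atTop (R := ℝ))).const_mul C
      simpa using h
    refine squeeze_zero' (Eventually.of_forall fun T => by positivity) ?_ hlim
    filter_upwards [hω] with T hT
    rw [← mul_div_assoc]
    exact div_le_div_of_nonneg_right hT (by positivity)

end Errors

end MatchingBandit

end

theorem theorem1 (N K : ℕ) (hNK : N ≤ K)
    (μ : Fin N → Fin K → ℝ) (hμ : ∀ i, Function.Injective (μ i))
    (η : Fin K → Fin N → ℝ) (hη : ∀ a, Function.Injective (η a))
    (lam : unitInterval) (hlam0 : 0 < (lam : ℝ)) (hlam1 : (lam : ℝ) < 1)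
    (τ : MatchingBandit.TieBreak N K)
    (hτ : ∀ t i (S : Finset (Fin K)), S.Nonempty → τ t i S ∈ S) :
    -- almost surely, from some round on, the arm selected by every player is one that
    -- CA-UCB may select
    (∀ᵐ ω ∂(MatchingBandit.law lam μ), ∀ᶠ t : ℕ in atTop, ∀ i,
      MatchingBandit.ocaChoice η τ ω (t + 1) (MatchingBandit.run η τ ω t) i ∈
        MatchingBandit.ucbArgmax ω (t + 1) (MatchingBandit.run η τ ω t) i
          (MatchingBandit.caPlausible η (MatchingBandit.run η τ ω t) i)) ∧
    -- almost surely, only `O(log² T)` of the first `T` matchings are unstable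
    (∃ C : ℝ, ∀ᵐ ω ∂(MatchingBandit.law lam μ), ∀ᶠ T : ℕ in atTop,
      (MatchingBandit.unstableRounds μ η τ ω T : ℝ) ≤ C * Real.log T ^ 2) ∧
    -- the expected fraction of unstable matchings tends to zero
    Tendsto (fun T : ℕ => (∑ t ∈ Finset.Icc 1 T, (MatchingBandit.law lam μ).real
        {ω | ¬ MatchingBandit.IsStable μ η (MatchingBandit.matchingAt η τ ω t)}) / (T : ℝ))
      atTop (𝓝 0) := by
  have hmin : 0 < min (lam : ℝ) (1 - lam) := lt_min hlam0 (sub_pos.2 hlam1)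
  have hε0 : 0 < min (lam : ℝ) (1 - lam) ^ N := pow_pos hmin N
  have hε1 : min (lam : ℝ) (1 - lam) ^ N ≤ 1 :=
    pow_le_one₀ hmin.le ((min_le_left _ _).trans hlam1.le)
  have hε := MatchingBandit.le_rowLaw (N := N) (lam := lam)
  obtain ⟨C, hC⟩ := MatchingBandit.exists_unstableRounds_le hNK hμ hη hτ hε0 hε1 hε
  refine ⟨?_, ⟨max C 0, ?_⟩, MatchingBandit.tendsto_unstable_fraction hNK hμ hη hC⟩
  · filter_upwards [MatchingBandit.ae_exploring_bounded (μ := μ) hNK hη hτ hε0 hε] with ω hω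
    filter_upwards [eventually_all.2 fun i =>
      MatchingBandit.eventually_not_of_count_le (hω i).choose_spec] with t ht i
    exact MatchingBandit.choice_mem_ucbArgmax_caPlausible hNK hτ ω t i (ht i)
  · filter_upwards [hC] with ω hω
    filter_upwards [hω, (Real.tendsto_log_atTop.comp
      tendsto_natCast_atTop_atTop).eventually_ge_atTop 1] with T hT hT1
    simp only [Function.comp_apply] at hT1
    calc (MatchingBandit.unstableRounds μ η τ ω T : ℝ) ≤ C * Real.log T := hT
      _ ≤ max C 0 * Real.log T :=
          mul_le_mul_of_nonneg_right (le_max_left _ _) (by linarith)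
      _ ≤ max C 0 * Real.log T ^ 2 :=
          mul_le_mul_of_nonneg_left (by nlinarith) (le_max_right _ _)
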